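/- Let $Y$ be a real Lévy process without negative jumps which is not a subordinator, with Laplace exponent $$\psi_Y(\theta)=\log\mathbb E[e^{-\theta Y_1}]=\gamma_Y\theta+\tfrac{\sigma^2}{2}\theta^2+\int_{(0,\infty)}\big(e^{-\theta x}-1+\theta x\mathbf 1_{\{x<1\}}\big)\Pi(dx),\qquad \theta\ge 0,$$ where $\gamma_Y\in\mathbb R$, $\sigma\ge0$ and $\int_{(0,\infty)}(1\wedge x^2)\,\Pi(dx)<\infty$, and suppose $\mathbb E[Y_1]=-\psi_Y'(0+)<\infty$. Fix $q>0$ and $\rho\in\mathbb R$. For $\delta>0$ let $\psi_X(\theta)=\psi_Y(\theta)+\delta\theta$ be the Laplace exponent of $X_t=Y_t-\delta t$. Let $\mathbb W^{(q)}$ and $W^{(q)}$ be the $q$-scale functions associated with $\psi_Y$ and $\psi_X$: they vanish on $(-\infty,0)$, are nonnegative, nondecreasing and (right-)continuous on $[0,\infty)$, and satisfy $\int_0^\infty e^{-\theta x}\mathbb W^{(q)}(x)\,dx=(\psi_Y(\theta)-q)^{-1}$ for $\theta>\sup\{\lambda\ge0:\psi_Y(\lambda)=q\}$, and likewise for $W^{(q)}$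 with $\psi_X$. Put $$Z^{(q)}(x)=1+q\int_0^xW^{(q)}(y)\,dy,\quad \overline Z^{(q)}(x)=\int_0^xZ^{(q)}(z)\,dz,\quad \mathbb Z^{(q)}(x)=1+q\int_0^x\mathbb W^{(q)}(y)\,dy,$$ and, for $\beta\in(0,1)$ and $0\le a\le b$, $$\Gamma(a,b)=\delta\,\mathbb Z^{(q)}(a)-q\rho-q\beta\Big(\overline Z^{(q)}(b)+\frac{\psi_X'(0+)}q+\delta\int_{b-a}^{b}\mathbb W^{(q)}(b-y)Z^{(q)}(y)\,dy\Big),\qquad \gamma(a,b)=\beta^{-1}-Z^{(q)}(b-a).$$ The scale functions exist, $\Gamma(0,0)=\delta-q\rho-\beta\psi_X'(0+)$, and there is exactly one pair $(a^*,b^*)$, called the optimal layer levels, for which one of the following holds: $a^*=b^*=0$ and $\Gamma(0,0)\le0$; or $a^*=0<b^*$, $\Gamma(0,b^*)=0$, $\gamma(0,b^*)\ge0$ and $\Gamma(0,0)>0$; or $0<a^*<b^*$, $\Gamma(a^*,b^*)=\gamma(a^*,b^*)=0$ and $\Gamma(0,0)>0$. In particular $b^*>0$ if and only if $\Gamma(0,0)>0$.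 Moreover: (i) Let $\beta\downarrow0$ with $\delta$ fixed. Then $\Gamma(0,0)\to\delta-q\rho$, and: 1. if $q\rho/\delta<1$, then $b^*\to\infty$; 2. if $q\rho/\delta>1$, then $a^*=b^*=0$ for all sufficiently small $\beta$; 3. if $q\rho/\delta=1$ and $\psi_X'(0+)<0$, then $b^*>0$ for all $\beta\in(0,1)$, $b^*\to(\overline Z^{(q)})^{-1}(-\psi_X'(0+)/q)>0$, $a^*=0$ for all sufficiently small $\beta$, and hence $a^*\to0$; 4. if $q\rho/\delta=1$ and $\psi_X'(0+)\ge0$, then $a^*=b^*=0$ for all $\beta\in(0,1)$. (ii) Let $\beta\uparrow1$ with $\delta$ fixed. Then $\Gamma(0,0)\to-\psi_Y'(0+)-q\rho$, and: 1. if $\psi_Y'(0+)+q\rho<0$, then for all $\beta<1$ sufficiently close to $1$ we have $0<a^*<b^*$ and $Z^{(q)}(b^*-a^*)=\beta^{-1}$; moreover $b^*-a^*\to0$; 2. if $\psi_Y'(0+)+q\rho>0$, then $a^*=b^*=0$ for all $\beta<1$ sufficiently close to $1$; 3. if $\psi_Y'(0+)+q\rho=0$ and $\psi_X'(0+)>0$,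 then $b^*>0$ for all $\beta\in(0,1)$, and $a^*\to0$, $b^*\to0$; 4. if $\psi_Y'(0+)+q\rho=0$ and $\psi_X'(0+)\le0$, then $a^*=b^*=0$ for all $\beta\in(0,1)$. (iii) Let $\delta\uparrow\infty$ with $\beta\in(0,1)$ fixed. Then $\Gamma(0,0)\to\infty$ and $b^*\to\infty$. -/

import Mathlib

open Set Filter Topology MeasureTheory

noncomputable section

/-- The characteristics `(γ, σ, ν)` of a real Lévy process `Y` without negative jumps;
`ν` is the Lévy measure, carried by `(0, ∞)`. -/
structure LevyTriplet where
  γ : ℝ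
  σ : ℝ
  ν : Measure ℝ
  σ_nonneg : 0 ≤ σ
  ν_Iic_zero : ν (Iic 0) = 0
  ν_lt_top : ∫⁻ x, ENNReal.ofReal (min 1 (x ^ 2)) ∂ν < ⊤

namespace LevyTriplet

/-- The Laplace exponent of `Y`: `E[exp (-θ Y_t)] = exp (t ψ_Y(θ))` for `θ ≥ 0`. -/
def psiY (L : LevyTriplet) (θ : ℝ) : ℝ :=
  L.γ * θ + L.σ ^ 2 / 2 * θ ^ 2 +
    ∫ x, (Real.exp (-θ * x) - 1 + if x < 1 then θ * x else 0) ∂L.ν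

/-- `Y` is not a subordinator: either its paths have unbounded variation (`σ > 0` or
`∫_{(0,1)} x ν(dx) = ∞`), or `Y_t = -c t + S_t` with `S` a driftless subordinator and
`c = γ + ∫_{(0,1)} x ν(dx) > 0`. -/
def NotSubordinator (L : LevyTriplet) : Prop :=
  0 < L.σ ∨ ¬ IntegrableOn (fun x : ℝ => x) (Ioo 0 1) L.ν ∨
    0 < L.γ + ∫ x in Ioo (0 : ℝ) 1, x ∂L.ν

/-- The Laplace exponent of `X_t = Y_t - δ t`. -/
def psiX (L : LevyTriplet) (δ θ : ℝ) : ℝ := L.psiY θ + δ * θ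

end LevyTriplet

/-- The right derivative `ψ'(0+)` of a Laplace exponent. -/
def rightDerivZero (ψ : ℝ → ℝ) : ℝ := derivWithin ψ (Ici 0) 0

/-- `Φ(q) = sup {l ≥ 0 : ψ(l) = q}`. -/
def rightInverse (ψ : ℝ → ℝ) (q : ℝ) : ℝ := sSup {l : ℝ | 0 ≤ l ∧ ψ l = q}

/-- `W` is the `q`-scale function of the spectrally negative Lévy process with Laplace
exponent `ψ`. Right-continuity and the Laplace transform already determine `W` uniquely;
that `W` is moreover continuous and strictly increasing on `[0, ∞)` is a consequence. -/
structure IsScaleFunction (ψ : ℝ → ℝ) (q : ℝ) (W : ℝ → ℝ) : Prop where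
  nonneg : ∀ x, 0 ≤ W x
  zero_of_neg : ∀ x < 0, W x = 0
  mono : MonotoneOn W (Ici 0)
  right_cont : ∀ x, 0 ≤ x → ContinuousWithinAt W (Ici x) x
  laplace : ∀ θ, rightInverse ψ q < θ →
    IntegrableOn (fun x => Real.exp (-θ * x) * W x) (Ioi 0) ∧
      ∫ x in Ioi (0 : ℝ), Real.exp (-θ * x) * W x = 1 / (ψ θ - q)

/-- The `q`-scale function of the process with Laplace exponent `ψ`. -/
def scaleFunction (ψ : ℝ → ℝ) (q : ℝ) : ℝ → ℝ := Classical.epsilon (IsScaleFunction ψ q)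

/-- `Z^{(q)}(x) = 1 + q ∫_0^x W^{(q)}(y) dy`. -/
def scaleZ (ψ : ℝ → ℝ) (q x : ℝ) : ℝ := 1 + q * ∫ y in (0 : ℝ)..x, scaleFunction ψ q y

/-- `∫_0^x Z^{(q)}(z) dz`. -/
def scaleZbar (ψ : ℝ → ℝ) (q x : ℝ) : ℝ := ∫ z in (0 : ℝ)..x, scaleZ ψ q z

namespace LevyTriplet

/-- `r̃_c(z) = Z̄_X(z) + ψ_X'(0+)/q + δ ∫_c^z W_Y(z - y) Z_X(y) dy`. -/
def rTilde (L : LevyTriplet) (q δ c z : ℝ) : ℝ :=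
  scaleZbar (L.psiX δ) q z + rightDerivZero (L.psiX δ) / q +
    δ * ∫ y in c..z, scaleFunction L.psiY q (z - y) * scaleZ (L.psiX δ) q y

/-- `Γ(a,b) = δ Z_Y(a) - q ρ - q β r̃_{b-a}(b)`. -/
def bigGamma (L : LevyTriplet) (q ρ δ β a b : ℝ) : ℝ :=
  δ * scaleZ L.psiY q a - q * ρ - q * β * L.rTilde q δ (b - a) b

/-- `γ(a,b) = 1/β - Z_X(b - a)`. -/
def smallGamma (L : LevyTriplet) (q δ β a b : ℝ) : ℝ := β⁻¹ - scaleZ (L.psiX δ) q (b - a)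

/-- `p = (a, b)` is the pair of optimal layer levels: liquidation `(0, 0)` if `Γ(0,0) ≤ 0`;
otherwise `b > 0` is the level at which `min_{0 ≤ a ≤ b} Γ(a,b)` vanishes and the minimum is
attained at `a`, either at `a = 0` (with `γ(0,b) ≥ 0`) or in the interior (with
`γ(a,b) = 0`). -/
def IsOptimalLevels (L : LevyTriplet) (q ρ δ β : ℝ) (p : ℝ × ℝ) : Prop :=
  (p.1 = 0 ∧ p.2 = 0 ∧ L.bigGamma q ρ δ β 0 0 ≤ 0) ∨
  (p.1 = 0 ∧ 0 < p.2 ∧ L.bigGamma q ρ δ β p.1 p.2 = 0 ∧ 0 ≤ L.smallGamma q δ β 0 p.2 ∧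
    0 < L.bigGamma q ρ δ β 0 0) ∨
  (0 < p.1 ∧ p.1 < p.2 ∧ L.bigGamma q ρ δ β p.1 p.2 = 0 ∧ L.smallGamma q δ β p.1 p.2 = 0 ∧
    0 < L.bigGamma q ρ δ β 0 0)

/-- The optimal lower (refraction) level `a*`. -/
def aStar (L : LevyTriplet) (q ρ δ β : ℝ) : ℝ :=
  (Classical.epsilon (L.IsOptimalLevels q ρ δ β)).1

/-- The optimal upper (reflection) level `b*`. -/
def bStar (L : LevyTriplet) (q ρ δ β : ℝ) : ℝ :=
  (Classical.epsilon (L.IsOptimalLevels q ρ δ β)).2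

end LevyTriplet

end

/-! Existence of scale functions. Let `φ > 0` solve `ψ(φ) = q` and let `d = ψ'(φ)`, which is
positive by convexity. Then `ψ(φ + l) - q = l (d + J(l))` with `J = tiltJump φ` a Bernstein function
(`psiY_add`). Consequently `d / (d + J)` is the Laplace transform of a sub-probability measure on
`[0, ∞)`; if `F` is its distribution function, `W(x) = exp(φ x) F(x) / d` has transform `1 / (ψ -
q)`. The measure is built by hand: when `J` has finite jump measure it is the law of a geometric
sum, and the general `J` is a limit of such. The substitution `y = exp(-x)` moves everything to `[0,
1]`, where compactness of the probability measures supplies the limit. The process `X` is covered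
too, being `Y` with `γ + δ` in place of `γ`.

The levels. By `bigGamma_eq`, `Γ(a,b) = Γ(0,0) - qβ Z̄_X(b) + qδ ∫_0^a W_Y(u) (1 - β Z_X(b - u))
du`. With `Z_X(k) = 1/β`, the integrand passes from nonpositive to nonnegative at `u = b - k`, so
for fixed `b` the minimum over `a` is attained at `a = max 0 (b - k)`. The minimum `minGamma` is
continuous and strictly decreasing in `b`, starts at `Γ(0,0)` and reaches nonpositive values. When
`Γ(0,0) > 0` its only zero is `b*`, and `a* = max 0 (b* - k)`; this is `isOptimalLevels_iff`.

The limits. `Γ(0,0)` is affine in `β` and in `δ`, and its sign decides whether `b* > 0`. The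
position of `b*` is controlled from below by `lt_bStar` and from above by `bStar_le`. As `β ↓ 0` the
threshold `1/β` exceeds any fixed `Z_X(b)`; as `β ↑ 1` it drops to `1`, forcing `k` to `0`; as `δ ↑
∞`, `Z_X(b)` falls to `1` while `Γ(0,0)` grows. -/

noncomputable section

/-! ### Moment functions on `[0, 1]` and their closure properties -/

/-- `f` restricted to `(0, ∞)` is the Mellin transform of a probability measure on `[0, 1]`;
equivalently, the Laplace transform of a sub-probability measure on `[0, ∞)`, whose missing mass
sits at the point `0` of `[0, 1]`. -/
def IsMomentFunction (f : ℝ → ℝ) : Prop :=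
  ∃ P : ProbabilityMeasure unitInterval, ∀ l > 0,
    f l = ∫ y : unitInterval, (y : ℝ) ^ l ∂(P : Measure unitInterval)

theorem continuous_unitInterval_rpow {l : ℝ} (hl : 0 < l) :
    Continuous fun y : unitInterval => (y : ℝ) ^ l :=
  continuous_subtype_val.rpow_const fun _ => Or.inr hl.le

theorem integrable_unitInterval_rpow (m : Measure unitInterval) [IsFiniteMeasure m] {l : ℝ}
    (hl : 0 < l) : Integrable (fun y : unitInterval => (y : ℝ) ^ l) m := by
  refine Integrable.of_bound (continuous_unitInterval_rpow hl).aestronglyMeasurable 1 ?_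
  refine Eventually.of_forall fun y => ?_
  rw [Real.norm_of_nonneg (Real.rpow_nonneg y.2.1 _)]
  exact Real.rpow_le_one y.2.1 y.2.2 hl.le

namespace IsMomentFunction

theorem congr {f g : ℝ → ℝ} (hf : IsMomentFunction f) (h : ∀ l > 0, f l = g l) :
    IsMomentFunction g := by
  obtain ⟨P, hP⟩ := hf
  exact ⟨P, fun l hl => (h l hl).symm.trans (hP l hl)⟩

theorem mem_Icc {f : ℝ → ℝ} (hf : IsMomentFunction f) {l : ℝ} (hl : 0 < l) :
    f l ∈ Icc (0 : ℝ) 1 := by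
  obtain ⟨P, hP⟩ := hf
  rw [hP l hl]
  refine ⟨integral_nonneg fun y => Real.rpow_nonneg y.2.1 _, ?_⟩
  calc ∫ y : unitInterval, (y : ℝ) ^ l ∂(P : Measure unitInterval)
      ≤ ∫ _ : unitInterval, (1 : ℝ) ∂(P : Measure unitInterval) :=
        integral_mono (integrable_unitInterval_rpow _ hl) (integrable_const _)
          fun y => Real.rpow_le_one y.2.1 y.2.2 hl.le
    _ = 1 := by simp

theorem zero : IsMomentFunction fun _ => 0 := by
  refine ⟨⟨Measure.dirac 0, inferInstance⟩, fun l hl => ?_⟩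
  simp [Real.zero_rpow hl.ne']

theorem one : IsMomentFunction fun _ => 1 := by
  refine ⟨⟨Measure.dirac 1, inferInstance⟩, fun l hl => ?_⟩
  simp

theorem convex_combination {f g : ℝ → ℝ} (hf : IsMomentFunction f) (hg : IsMomentFunction g)
    {s t : ℝ} (hs : 0 ≤ s) (ht : 0 ≤ t) (hst : s + t = 1) :
    IsMomentFunction fun l => s * f l + t * g l := by
  obtain ⟨P, hP⟩ := hf
  obtain ⟨Q, hQ⟩ := hg
  refine ⟨⟨ENNReal.ofReal s • (P : Measure unitInterval) +
    ENNReal.ofReal t • (Q : Measure unitInterval), ⟨?_⟩⟩, fun l hl => ?_⟩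
  · simp [← ENNReal.ofReal_add hs ht, hst]
  · have h1 := (integrable_unitInterval_rpow (P : Measure unitInterval) hl).smul_measure
      (ENNReal.ofReal_ne_top (r := s))
    have h2 := (integrable_unitInterval_rpow (Q : Measure unitInterval) hl).smul_measure
      (ENNReal.ofReal_ne_top (r := t))
    simp only [ProbabilityMeasure.coe_mk]
    rw [integral_add_measure h1 h2, integral_smul_measure, integral_smul_measure,
      ENNReal.toReal_ofReal hs, ENNReal.toReal_ofReal ht, hP l hl, hQ l hl]
    rfl

theorem mul {f g : ℝ → ℝ} (hf : IsMomentFunction f) (hg : IsMomentFunction g) :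
    IsMomentFunction fun l => f l * g l := by
  obtain ⟨P, hP⟩ := hf
  obtain ⟨Q, hQ⟩ := hg
  have hm : Measurable fun p : unitInterval × unitInterval => p.1 * p.2 := by fun_prop
  refine ⟨⟨((P : Measure unitInterval).prod (Q : Measure unitInterval)).map
    fun p => p.1 * p.2, Measure.isProbabilityMeasure_map hm.aemeasurable⟩, fun l hl => ?_⟩
  simp only [ProbabilityMeasure.coe_mk]
  rw [integral_map hm.aemeasurable (continuous_unitInterval_rpow hl).aestronglyMeasurable,
    hP l hl, hQ l hl, ← integral_prod_mul]
  refine integral_congr_ae (Eventually.of_forall fun p => ?_)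
  simp [Real.mul_rpow p.1.2.1 p.2.2.1]

/-- Moment functions are closed under pointwise limits, by compactness of the space of
probability measures on `[0, 1]`. -/
theorem of_tendsto {F : ℕ → ℝ → ℝ} {f : ℝ → ℝ} (hF : ∀ n, IsMomentFunction (F n))
    (h : ∀ l > 0, Tendsto (fun n => F n l) atTop (𝓝 (f l))) : IsMomentFunction f := by
  choose P hP using hF
  have hcpt : IsCompact (univ : Set (ProbabilityMeasure unitInterval)) := isCompact_univ
  -- A limit along one free ultrafilter on `ℕ` suffices: the values `F n l` converge anyway, so
  -- their limit is also the limit along the ultrafilter.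
  obtain ⟨Q, -, hQ⟩ := hcpt.ultrafilter_le_nhds ((hyperfilter ℕ).map P) (by simp)
  have hQ' : Tendsto P (hyperfilter ℕ : Filter ℕ) (𝓝 Q) := hQ
  refine ⟨Q, fun l hl => ?_⟩
  have h1 := (ProbabilityMeasure.tendsto_iff_forall_integral_tendsto.1 hQ')
    (BoundedContinuousFunction.mkOfCompact ⟨_, continuous_unitInterval_rpow hl⟩)
  have h2 : Tendsto (fun n => F n l) (hyperfilter ℕ : Filter ℕ) (𝓝 (f l)) :=
    (h l hl).mono_left (Nat.hyperfilter_le_atTop)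
  refine tendsto_nhds_unique h2 ?_
  simpa [hP _ l hl] using h1

/-- If `g` is a moment function and `h = M * (1 - g)`, then `d / (d + h)` is again a moment
function: the transform of the law of a geometric sum. -/
theorem geometric {g : ℝ → ℝ} (hg : IsMomentFunction g) {d M : ℝ} (hd : 0 < d) (hM : 0 ≤ M) :
    IsMomentFunction fun l => d / (d + M * (1 - g l)) := by
  have hdM : 0 < d + M := by positivity
  -- Iterates from `0` of the affine map whose fixed point is `d / (d + M (1 - g))`. They are
  -- partial sums of a geometric series of ratio `M g / (d + M) < 1`, and each step is a convex
  -- combination.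
  let F : ℕ → ℝ → ℝ := fun n => Nat.rec (fun _ => 0)
    (fun _ f l => d / (d + M) * 1 + M / (d + M) * (g l * f l)) n
  have hFs : ∀ n l, F (n + 1) l = d / (d + M) * 1 + M / (d + M) * (g l * F n l) :=
    fun n l => rfl
  have hF : ∀ n, IsMomentFunction (F n) := by
    intro n
    induction n with
    | zero => exact zero
    | succ n ih =>
      exact one.convex_combination (hg.mul ih) (by positivity) (by positivity)
        (by field_simp)
  refine of_tendsto hF fun l hl => ?_
  obtain ⟨hg0, hg1⟩ := hg.mem_Icc hl
  have hden : 0 < d + M * (1 - g l) := by nlinarith [mul_nonneg hM (sub_nonneg.2 hg1)]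
  have hr0 : 0 ≤ M / (d + M) * g l := by positivity
  have hr1 : M / (d + M) * g l < 1 := by
    rw [div_mul_eq_mul_div, div_lt_one hdM]; linarith
  have hform : ∀ n, F n l = d / (d + M * (1 - g l)) * (1 - (M / (d + M) * g l) ^ n) := by
    intro n
    induction n with
    | zero => simp [F]
    | succ n ih =>
      rw [hFs, ih, pow_succ]
      field_simp
      ring
  have := ((tendsto_pow_atTop_nhds_zero_of_lt_one hr0 hr1).const_sub 1).const_mul
    (d / (d + M * (1 - g l)))
  simp only [sub_zero, mul_one] at this
  exact this.congr fun n => (hform n).symm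

/-- The reciprocal of the Bernstein function `d + ∫ (1 - y ^ l) m(dy)` with `m` finite. -/
theorem of_finite_measure (m : Measure unitInterval) [IsFiniteMeasure m] {d : ℝ} (hd : 0 < d) :
    IsMomentFunction fun l => d / (d + ∫ y : unitInterval, (1 - (y : ℝ) ^ l) ∂m) := by
  by_cases hm : m = 0
  · refine one.congr fun l hl => ?_
    simp [hm, hd.ne']
  have hne : m univ ≠ 0 := by simpa using hm
  have hpos : 0 < m.real univ := ENNReal.toReal_pos hne (measure_ne_top _ _)
  have hP : IsProbabilityMeasure ((m univ)⁻¹ • m) :=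
    ⟨by simp [ENNReal.inv_mul_cancel hne (measure_ne_top _ _)]⟩
  have hg : IsMomentFunction fun l => (m.real univ)⁻¹ * ∫ y : unitInterval, (y : ℝ) ^ l ∂m := by
    refine ⟨⟨_, hP⟩, fun l hl => ?_⟩
    simp only [ProbabilityMeasure.coe_mk]
    rw [integral_smul_measure]
    simp [Measure.real]
  refine (hg.geometric hd hpos.le).congr fun l hl => ?_
  rw [integral_sub (integrable_const _) (integrable_unitInterval_rpow m hl)]
  simp only [integral_const, smul_eq_mul, mul_one]
  rw [mul_sub, mul_one, mul_inv_cancel_left₀ hpos.ne']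

end IsMomentFunction

/-! ### Bounds and continuity of the Laplace exponent -/

theorem Real.exp_neg_sub_one_add_nonneg (u : ℝ) : 0 ≤ Real.exp (-u) - 1 + u := by
  linarith [Real.add_one_le_exp (-u)]

theorem Real.exp_neg_sub_one_add_le_sq {u : ℝ} (hu : 0 ≤ u) : Real.exp (-u) - 1 + u ≤ u ^ 2 := by
  have h1 : Real.exp (-u) ≤ (1 + u)⁻¹ := by
    rw [Real.exp_neg]
    exact inv_anti₀ (by positivity) (by linarith [Real.add_one_le_exp u])
  have h2 : (1 + u)⁻¹ - 1 + u ≤ u ^ 2 := by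
    have : (1 + u)⁻¹ - 1 + u = u ^ 2 / (1 + u) := by field_simp; ring
    rw [this]
    exact div_le_self (by positivity) (by linarith)
  linarith

namespace LevyTriplet

theorem ae_pos (L : LevyTriplet) : ∀ᵐ x ∂L.ν, 0 < x := by
  have := L.ν_Iic_zero
  rw [ae_iff]
  simp only [not_lt]
  exact this

theorem integrable_min (L : LevyTriplet) : Integrable (fun x : ℝ => min 1 (x ^ 2)) L.ν := by
  refine ⟨by fun_prop, ?_⟩
  rw [hasFiniteIntegral_iff_ofReal (Eventually.of_forall fun x => by positivity)]
  exact L.ν_lt_top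

theorem integrable_of_le_min (L : LevyTriplet) {f : ℝ → ℝ} (hf : Measurable f) {C : ℝ}
    (h : ∀ x > 0, |f x| ≤ C * min 1 (x ^ 2)) : Integrable f L.ν :=
  (L.integrable_min.const_mul C).mono' hf.aestronglyMeasurable
    (L.ae_pos.mono fun x hx => h x hx)

/-- The integrand of the Lévy–Khintchine formula. -/
def kernel (θ x : ℝ) : ℝ := Real.exp (-θ * x) - 1 + if x < 1 then θ * x else 0

theorem measurable_kernel (θ : ℝ) : Measurable (kernel θ) := by
  unfold kernel
  refine Measurable.add (by fun_prop) (Measurable.ite measurableSet_Iio (by fun_prop) (by fun_prop))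

theorem abs_kernel_le {θ x : ℝ} (hθ : 0 ≤ θ) (hx : 0 < x) :
    |kernel θ x| ≤ (1 + θ ^ 2) * min 1 (x ^ 2) := by
  unfold kernel
  rw [neg_mul]
  have hu : 0 ≤ θ * x := by positivity
  split_ifs with h
  · have h2 : x ^ 2 ≤ 1 := by nlinarith
    rw [min_eq_right h2, abs_of_nonneg (Real.exp_neg_sub_one_add_nonneg _)]
    nlinarith [Real.exp_neg_sub_one_add_le_sq hu, sq_nonneg x]
  · have h2 : 1 ≤ x ^ 2 := by nlinarith
    rw [min_eq_left h2, abs_le]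
    have := Real.exp_pos (-(θ * x))
    have := Real.exp_le_one_iff.2 (neg_nonpos.2 hu)
    constructor <;> nlinarith

/-- Unlike `abs_kernel_le`, this bound is uniform in `θ`, which `exists_psiY_pos` needs as `θ → ∞`.
-/
theorem neg_min_le_kernel {θ x : ℝ} (hx : 0 < x) : -min 1 (x ^ 2) ≤ kernel θ x := by
  unfold kernel
  rw [neg_mul]
  split_ifs with h
  · have : 0 ≤ min 1 (x ^ 2) := by positivity
    linarith [Real.exp_neg_sub_one_add_nonneg (θ * x)]
  · have h2 : 1 ≤ x ^ 2 := by nlinarith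
    rw [min_eq_left h2]
    linarith [Real.exp_pos (-(θ * x))]

theorem integrable_kernel (L : LevyTriplet) {θ : ℝ} (hθ : 0 ≤ θ) :
    Integrable (kernel θ) L.ν :=
  L.integrable_of_le_min (measurable_kernel θ) fun _ hx => abs_kernel_le hθ hx

theorem psiY_eq (L : LevyTriplet) (θ : ℝ) :
    L.psiY θ = L.γ * θ + L.σ ^ 2 / 2 * θ ^ 2 + ∫ x, kernel θ x ∂L.ν := rfl

theorem psiY_zero (L : LevyTriplet) : L.psiY 0 = 0 := by simp [psiY]

theorem continuousOn_psiY (L : LevyTriplet) (R : ℝ) : ContinuousOn L.psiY (Icc 0 R) := by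
  have : ContinuousOn (fun θ => ∫ x, kernel θ x ∂L.ν) (Icc 0 R) := by
    refine continuousOn_of_dominated (bound := fun x => (1 + R ^ 2) * min 1 (x ^ 2))
      (fun θ _ => (measurable_kernel θ).aestronglyMeasurable) (fun θ hθ => ?_)
      (L.integrable_min.const_mul _) (Eventually.of_forall fun x => ?_)
    · filter_upwards [L.ae_pos] with x hx
      refine (abs_kernel_le hθ.1 hx).trans ?_
      have : θ ^ 2 ≤ R ^ 2 := pow_le_pow_left₀ hθ.1 hθ.2 2
      gcongr
    · unfold kernel
      split_ifs <;> fun_prop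
  exact ((by fun_prop : Continuous fun θ : ℝ => L.γ * θ + L.σ ^ 2 / 2 * θ ^ 2).continuousOn).add
    this

/-- A quadratic upper bound for the Laplace exponent. -/
theorem exists_psiY_le_sq (L : LevyTriplet) : ∃ C, ∀ θ ≥ 1, L.psiY θ ≤ C * θ ^ 2 := by
  refine ⟨|L.γ| + L.σ ^ 2 / 2 + 2 * ∫ x, min 1 (x ^ 2) ∂L.ν, fun θ hθ => ?_⟩
  have h0 : 0 ≤ ∫ x, min 1 (x ^ 2) ∂L.ν := integral_nonneg fun x => by positivity
  have h1 : ∫ x, kernel θ x ∂L.ν ≤ (1 + θ ^ 2) * ∫ x, min 1 (x ^ 2) ∂L.ν := by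
    rw [← integral_const_mul]
    refine integral_mono_ae (L.integrable_kernel (by linarith)) (L.integrable_min.const_mul _) ?_
    filter_upwards [L.ae_pos] with x hx
    exact (le_abs_self _).trans (abs_kernel_le (by linarith) hx)
  have h2 : L.γ * θ ≤ |L.γ| * θ ^ 2 := by
    have := mul_le_mul_of_nonneg_right (le_abs_self L.γ) (by linarith : 0 ≤ θ)
    nlinarith [mul_nonneg (abs_nonneg L.γ) (by nlinarith : 0 ≤ θ ^ 2 - θ)]
  rw [psiY_eq]
  nlinarith [mul_nonneg h0 (by nlinarith : 0 ≤ θ ^ 2 - 1)]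

/-! ### Increments of the Laplace exponent beyond a point `φ > 0` -/

/-- The derivative `ψ'(φ)` at `φ > 0`. -/
def tiltDrift (L : LevyTriplet) (φ : ℝ) : ℝ :=
  L.γ + L.σ ^ 2 * φ + ∫ x, ((if x < 1 then x else 0) - x * Real.exp (-φ * x)) ∂L.ν

/-- The part of `(ψ(φ + l) - ψ(φ)) / l` beyond `ψ'(φ)`: a Bernstein function of `l`. -/
def tiltJump (L : LevyTriplet) (φ l : ℝ) : ℝ :=
  L.σ ^ 2 / 2 * l + ∫ x, Real.exp (-φ * x) * (x - (1 - Real.exp (-l * x)) / l) ∂L.ν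

theorem mul_exp_neg_le {φ x : ℝ} (hφ : 0 < φ) : x * Real.exp (-φ * x) ≤ φ⁻¹ := by
  have h := Real.add_one_le_exp (φ * x)
  have hp := Real.exp_pos (-φ * x)
  have h1 : Real.exp (φ * x) * Real.exp (-φ * x) = 1 := by
    rw [← Real.exp_add]; simp
  rw [← one_div, le_div_iff₀ hφ]
  nlinarith

theorem integrable_tiltDrift (L : LevyTriplet) {φ : ℝ} (hφ : 0 < φ) :
    Integrable (fun x => (if x < 1 then x else 0) - x * Real.exp (-φ * x)) L.ν := by
  refine L.integrable_of_le_min (C := φ + φ⁻¹)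
    ((Measurable.ite measurableSet_Iio (by fun_prop) (by fun_prop)).sub (by fun_prop))
    fun x hx => ?_
  have hi : 0 < φ⁻¹ := inv_pos.2 hφ
  split_ifs with h
  · have h2 : x ^ 2 ≤ 1 := by nlinarith
    have h3 := Real.add_one_le_exp (-φ * x)
    have h4 : Real.exp (-φ * x) ≤ 1 := Real.exp_le_one_iff.2 (by nlinarith [mul_pos hφ hx])
    rw [min_eq_right h2, abs_of_nonneg (by nlinarith)]
    nlinarith [mul_pos hi (pow_pos hx 2)]
  · have h2 : 1 ≤ x ^ 2 := by nlinarith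
    rw [min_eq_left h2, zero_sub, abs_neg, abs_of_nonneg (by positivity)]
    linarith [mul_exp_neg_le (x := x) hφ]

theorem tiltJump_integrand_eq {φ l : ℝ} (hl : 0 < l) (x : ℝ) :
    Real.exp (-φ * x) * (x - (1 - Real.exp (-l * x)) / l) =
      (kernel (φ + l) x - kernel φ x) / l -
        ((if x < 1 then x else 0) - x * Real.exp (-φ * x)) := by
  have : Real.exp (-(φ + l) * x) = Real.exp (-φ * x) * Real.exp (-l * x) := by
    rw [← Real.exp_add]; ring_nf
  unfold kernel
  rw [this]
  split_ifs <;> field_simp <;> ring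

theorem tiltJump_integrand_nonneg {φ l : ℝ} (hl : 0 < l) (x : ℝ) :
    0 ≤ Real.exp (-φ * x) * (x - (1 - Real.exp (-l * x)) / l) := by
  refine mul_nonneg (Real.exp_pos _).le (sub_nonneg.2 ?_)
  rw [div_le_iff₀ hl]
  linarith [Real.add_one_le_exp (-l * x)]

theorem integrable_tiltJump (L : LevyTriplet) {φ l : ℝ} (hφ : 0 < φ) (hl : 0 < l) :
    Integrable (fun x => Real.exp (-φ * x) * (x - (1 - Real.exp (-l * x)) / l)) L.ν := by
  simp_rw [tiltJump_integrand_eq hl]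
  exact (((L.integrable_kernel (by positivity)).sub (L.integrable_kernel hφ.le)).div_const l).sub
    (L.integrable_tiltDrift hφ)

theorem tiltJump_nonneg (L : LevyTriplet) (φ : ℝ) {l : ℝ} (hl : 0 < l) : 0 ≤ L.tiltJump φ l :=
  add_nonneg (by positivity) (integral_nonneg fun x => tiltJump_integrand_nonneg hl x)

theorem psiY_add (L : LevyTriplet) {φ l : ℝ} (hφ : 0 < φ) (hl : 0 < l) :
    L.psiY (φ + l) - L.psiY φ = l * (L.tiltDrift φ + L.tiltJump φ l) := by
  have h1 := L.integrable_kernel (θ := φ + l) (by positivity)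
  have h2 := L.integrable_kernel hφ.le
  unfold tiltJump tiltDrift
  simp_rw [tiltJump_integrand_eq hl]
  rw [integral_sub (by exact (h1.sub h2).div_const l) (L.integrable_tiltDrift hφ),
    integral_div, integral_sub h1 h2, psiY_eq, psiY_eq]
  field_simp
  ring

/-- Convexity of `ψ` together with `ψ(0) = 0`: the chord from the origin is no steeper than the
tangent at `φ`. Pointwise in `x` it amounts to `(1 + φ x) exp(-φ x) ≤ 1`. It makes `ψ'(φ)` positive
wherever `ψ(φ)` is. -/
theorem psiY_le_mul_tiltDrift (L : LevyTriplet) {φ : ℝ} (hφ : 0 < φ) :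
    L.psiY φ ≤ φ * L.tiltDrift φ := by
  have h : ∫ x, kernel φ x ∂L.ν ≤
      ∫ x, φ * ((if x < 1 then x else 0) - x * Real.exp (-φ * x)) ∂L.ν := by
    refine integral_mono (L.integrable_kernel hφ.le) ((L.integrable_tiltDrift hφ).const_mul φ)
      fun x => ?_
    have h := Real.add_one_le_exp (φ * x)
    have hp := Real.exp_pos (-φ * x)
    have h1 : Real.exp (φ * x) * Real.exp (-φ * x) = 1 := by
      rw [← Real.exp_add]; simp
    unfold kernel
    split_ifs <;> nlinarith
  rw [integral_const_mul] at h
  rw [psiY_eq, tiltDrift]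
  nlinarith [sq_nonneg (L.σ * φ)]

/-- If `σ > 0` the quadratic term wins. Otherwise, if `ψ ≤ 0` on `(0, ∞)`, dividing by `θ → ∞` and
applying Fatou gives `∫_{(0,1)} x ν(dx) ≤ -γ`, which is exactly the subordinator case. -/
theorem exists_psiY_pos (L : LevyTriplet) (hL : L.NotSubordinator) : ∃ θ > 0, 0 < L.psiY θ := by
  set K := ∫ x, min 1 (x ^ 2) ∂L.ν with hK
  have hK0 : 0 ≤ K := integral_nonneg fun x => by positivity
  have hmin : ∀ θ ≥ 0, -K ≤ ∫ x, kernel θ x ∂L.ν := fun θ hθ => by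
    rw [hK, ← integral_neg]
    refine integral_mono_ae L.integrable_min.neg (L.integrable_kernel hθ) ?_
    filter_upwards [L.ae_pos] with x hx using neg_min_le_kernel hx
  by_cases hσ : 0 < L.σ
  · have hs : 0 < L.σ ^ 2 / 2 := by positivity
    -- Chosen so that `σ² θ / 2` exceeds `|γ| + K`; as `θ ≥ 1`, the quadratic term then dominates
    -- both the drift and the jump contribution `-K`.
    refine ⟨1 + (|L.γ| + K) / (L.σ ^ 2 / 2), by positivity, ?_⟩
    set θ := 1 + (|L.γ| + K) / (L.σ ^ 2 / 2) with hθ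
    have h1 : 1 ≤ θ := by rw [hθ]; linarith [show 0 ≤ (|L.γ| + K) / (L.σ ^ 2 / 2) by positivity]
    have h2 : L.σ ^ 2 / 2 * θ = L.σ ^ 2 / 2 + (|L.γ| + K) := by rw [hθ]; field_simp
    have h3 := hmin θ (by linarith)
    rw [psiY_eq]
    have h4 : L.σ ^ 2 / 2 * θ ^ 2 = (L.σ ^ 2 / 2 + (|L.γ| + K)) * θ := by rw [← h2]; ring
    rw [h4]
    nlinarith [neg_abs_le L.γ]
  by_contra! hcon
  -- This is `ψ(n + 1) ≤ 0` divided by `n + 1`, with the nonnegative Gaussian term dropped; the part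
  -- of the integral outside `(0, 1)` costs at most `K`.
  have hbound : ∀ n : ℕ, ∫ x in Ioo (0 : ℝ) 1, kernel (n + 1) x / (n + 1) ∂L.ν ≤
      -L.γ + K / (n + 1) := fun n => by
    have hn : (0 : ℝ) < n + 1 := by positivity
    have h1 : ∫ x in Ioo (0 : ℝ) 1, kernel (n + 1) x ∂L.ν ≤ (∫ x, kernel (n + 1) x ∂L.ν) + K := by
      rw [← integral_indicator measurableSet_Ioo, hK,
        ← integral_add (L.integrable_kernel hn.le) L.integrable_min]
      refine integral_mono_ae ((L.integrable_kernel hn.le).indicator measurableSet_Ioo)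
        ((L.integrable_kernel hn.le).add L.integrable_min) ?_
      filter_upwards [L.ae_pos] with x hx
      have := neg_min_le_kernel (θ := n + 1) hx
      have : 0 ≤ min 1 (x ^ 2) := by positivity
      by_cases hx1 : x ∈ Ioo (0 : ℝ) 1
      · simp only [indicator_of_mem hx1]; linarith
      · simp only [indicator_of_notMem hx1]; linarith
    have h2 := hcon (n + 1) hn
    rw [psiY_eq] at h2
    have h3 : 0 ≤ L.σ ^ 2 / 2 * ((n : ℝ) + 1) ^ 2 := by positivity
    rw [integral_div, div_le_iff₀ hn, add_mul, div_mul_cancel₀ _ hn.ne']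
    linarith
  have hnn : ∀ n : ℕ, ∀ᵐ x ∂L.ν.restrict (Ioo 0 1), 0 ≤ kernel (n + 1) x / (n + 1) := fun n => by
    refine (ae_restrict_iff' measurableSet_Ioo).2 (Eventually.of_forall fun x hx => ?_)
    have : 0 ≤ kernel (n + 1) x := by
      rw [kernel, if_pos hx.2, neg_mul]
      exact Real.exp_neg_sub_one_add_nonneg _
    positivity
  have hint : ∀ n : ℕ, Integrable (fun x => kernel (n + 1) x / (n + 1)) (L.ν.restrict (Ioo 0 1)) :=
    fun n => ((L.integrable_kernel (by positivity)).div_const _).restrict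
  have hlim : Tendsto (fun n : ℕ => -L.γ + K / ((n : ℝ) + 1)) atTop (𝓝 (-L.γ)) := by
    simpa [div_eq_mul_inv] using
      ((tendsto_one_div_add_atTop_nhds_zero_nat (𝕜 := ℝ)).const_mul K).const_add (-L.γ)
  have hγ : 0 ≤ -L.γ :=
    ge_of_tendsto' hlim fun n => (integral_nonneg_of_ae (hnn n)).trans (hbound n)
  -- On `(0, 1)` one has `kernel θ x / θ = x - (1 - exp(-θ x)) / θ`, which tends to `x`.
  have hfatou : ∫⁻ x in Ioo (0 : ℝ) 1, ENNReal.ofReal x ∂L.ν ≤ ENNReal.ofReal (-L.γ) := by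
    have hpt : ∀ᵐ x ∂L.ν.restrict (Ioo 0 1), ENNReal.ofReal x =
        liminf (fun n : ℕ => ENNReal.ofReal (kernel (n + 1) x / (n + 1))) atTop := by
      refine (ae_restrict_iff' measurableSet_Ioo).2 (Eventually.of_forall fun x hx => ?_)
      refine (Tendsto.liminf_eq (ENNReal.tendsto_ofReal ?_)).symm
      have h0 := (tendsto_one_div_add_atTop_nhds_zero_nat (𝕜 := ℝ))
      refine tendsto_of_tendsto_of_tendsto_of_le_of_le (by simpa using h0.const_sub x)
        (tendsto_const_nhds (x := x)) (fun n => ?_) fun n => ?_ <;>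
      · have hn : (0 : ℝ) < n + 1 := by positivity
        have hp := Real.exp_pos (-(n + 1 : ℝ) * x)
        have h1 : Real.exp (-(n + 1 : ℝ) * x) ≤ 1 :=
          Real.exp_le_one_iff.2 (by nlinarith [mul_pos hn hx.1])
        simp only [kernel, if_pos hx.2]
        rw [add_div, mul_div_cancel_left₀ _ hn.ne']
        have h2 : (Real.exp (-(n + 1 : ℝ) * x) - 1) / (n + 1) ≤ 0 :=
          div_nonpos_of_nonpos_of_nonneg (by linarith) hn.le
        have h3 : -(1 / (n + 1 : ℝ)) ≤ (Real.exp (-(n + 1 : ℝ) * x) - 1) / (n + 1) := by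
          rw [← neg_div]; gcongr; linarith
        rw [one_div] at h3
        linarith
    calc ∫⁻ x in Ioo (0 : ℝ) 1, ENNReal.ofReal x ∂L.ν
        = ∫⁻ x in Ioo (0 : ℝ) 1,
            liminf (fun n : ℕ => ENNReal.ofReal (kernel (n + 1) x / (n + 1))) atTop ∂L.ν :=
          lintegral_congr_ae hpt
      _ ≤ liminf (fun n : ℕ => ∫⁻ x in Ioo (0 : ℝ) 1,
            ENNReal.ofReal (kernel (n + 1) x / (n + 1)) ∂L.ν) atTop :=
          lintegral_liminf_le fun n => ((measurable_kernel _).div_const _).ennreal_ofReal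
      _ ≤ liminf (fun n : ℕ => ENNReal.ofReal (-L.γ + K / ((n : ℝ) + 1))) atTop := by
          refine liminf_le_liminf (Eventually.of_forall fun n => ?_)
          rw [← ofReal_integral_eq_lintegral_ofReal (hint n) (hnn n)]
          exact ENNReal.ofReal_le_ofReal (hbound n)
      _ = ENNReal.ofReal (-L.γ) := (ENNReal.tendsto_ofReal hlim).liminf_eq
  have hnonneg : ∀ᵐ x ∂L.ν.restrict (Ioo 0 1), (0 : ℝ) ≤ x :=
    (ae_restrict_iff' measurableSet_Ioo).2 (Eventually.of_forall fun x hx => hx.1.le)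
  have hxint : IntegrableOn (fun x : ℝ => x) (Ioo 0 1) L.ν := by
    refine ⟨by fun_prop, ?_⟩
    rw [hasFiniteIntegral_iff_ofReal hnonneg]
    exact hfatou.trans_lt ENNReal.ofReal_lt_top
  rw [← ofReal_integral_eq_lintegral_ofReal hxint hnonneg, ENNReal.ofReal_le_ofReal_iff hγ]
    at hfatou
  rcases hL with h | h | h
  · exact hσ h
  · exact h hxint
  · linarith

theorem exists_psiY_eq (L : LevyTriplet) (hL : L.NotSubordinator) {q : ℝ} (hq : 0 < q) :
    ∃ φ > 0, L.psiY φ = q := by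
  obtain ⟨θ, hθ, hpos⟩ := L.exists_psiY_pos hL
  have hlow : ∀ l > 0, L.psiY θ * l / θ ≤ L.psiY (θ + l) := fun l hl => by
    have h1 := L.psiY_add hθ hl
    have h2 := L.psiY_le_mul_tiltDrift hθ
    have h3 := L.tiltJump_nonneg θ hl
    rw [div_le_iff₀ hθ]
    nlinarith [mul_nonneg (mul_nonneg hl.le h3) hθ.le, mul_le_mul_of_nonneg_left h2 hl.le,
      mul_pos hpos hθ]
  -- The value of `l` at which the linear lower bound `ψ(θ) l / θ` equals `q`.
  set l := q * θ / L.psiY θ with hl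
  have hl0 : 0 < l := by positivity
  have hR : q ≤ L.psiY (θ + l) := by
    refine le_trans (le_of_eq ?_) (hlow l hl0)
    rw [hl]; field_simp
  obtain ⟨φ, hφ, hφq⟩ := intermediate_value_Icc (by positivity : 0 ≤ θ + l)
    (L.continuousOn_psiY (θ + l)) ⟨by rw [psiY_zero]; exact hq.le, hR⟩
  refine ⟨φ, lt_of_le_of_ne hφ.1 ?_, hφq⟩
  rintro rfl
  rw [psiY_zero] at hφq
  linarith

theorem lt_psiY_of_lt (L : LevyTriplet) {q φ θ : ℝ} (hq : 0 < q) (hφ : 0 < φ)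
    (h : L.psiY φ = q) (hθ : φ < θ) : q < L.psiY θ := by
  have h1 := L.psiY_add hφ (sub_pos.2 hθ)
  have h2 := L.psiY_le_mul_tiltDrift hφ
  have h3 := L.tiltJump_nonneg φ (sub_pos.2 hθ)
  have h4 : 0 < L.tiltDrift φ := by
    by_contra! hc
    nlinarith
  rw [add_sub_cancel] at h1
  have := mul_pos (sub_pos.2 hθ) (add_pos_of_pos_of_nonneg h4 h3)
  linarith

theorem rightInverse_eq (L : LevyTriplet) {q φ : ℝ} (hq : 0 < q) (hφ : 0 < φ)
    (h : L.psiY φ = q) : rightInverse L.psiY q = φ := by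
  refine IsGreatest.csSup_eq ⟨⟨hφ.le, h⟩, fun l hl => ?_⟩
  by_contra! hlt
  linarith [L.lt_psiY_of_lt hq hφ h hlt, hl.2]

end LevyTriplet

/-! ### The tilted exponent as a limit of Bernstein functions with finite jump measure -/

theorem integral_one_sub_exp_neg_mul {c : ℝ} (hc : c ≠ 0) :
    ∫ t in (0 : ℝ)..1, (1 - Real.exp (-(c * t))) = 1 - (1 - Real.exp (-c)) / c := by
  have h : ∀ t ∈ uIcc (0 : ℝ) 1,
      HasDerivAt (fun t => t + Real.exp (-(c * t)) / c) (1 - Real.exp (-(c * t))) t := by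
    intro t _
    have h1 : HasDerivAt (fun t : ℝ => -(c * t)) (-c) t := by
      simpa using ((hasDerivAt_id' t).const_mul c).fun_neg
    refine ((hasDerivAt_id t).add (h1.exp.div_const c)).congr_deriv ?_
    field_simp
    ring
  rw [intervalIntegral.integral_eq_sub_of_hasDerivAt h
    ((by fun_prop : Continuous fun t => 1 - Real.exp (-(c * t))).intervalIntegrable _ _)]
  simp
  field_simp
  ring

namespace LevyTriplet

/-- The part of the jump measure of the Bernstein function `tiltJump` that comes from the jumps of
the Lévy process above `ε`; a jump of size `y` is recorded as the point `exp (-y)`. -/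
def tiltJumpMeasure (L : LevyTriplet) (φ ε : ℝ) : Measure unitInterval :=
  (((L.ν.restrict (Ioi ε)).withDensity fun x => ENNReal.ofReal (x * Real.exp (-φ * x))).prod
    (volume.restrict (Icc (0 : ℝ) 1))).map
      fun p => projIcc 0 1 zero_le_one (Real.exp (-(p.1 * p.2)))

theorem measurable_projIcc_exp :
    Measurable fun p : ℝ × ℝ => projIcc (0 : ℝ) 1 zero_le_one (Real.exp (-(p.1 * p.2))) :=
  (continuous_projIcc.comp (by fun_prop)).measurable

theorem isFiniteMeasure_withDensity (L : LevyTriplet) {φ ε : ℝ} (hφ : 0 < φ) (hε : 0 < ε) :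
    IsFiniteMeasure
      ((L.ν.restrict (Ioi ε)).withDensity fun x => ENNReal.ofReal (x * Real.exp (-φ * x))) := by
  refine isFiniteMeasure_withDensity_ofReal ?_
  have h : Integrable ((Ioi ε).indicator fun x => x * Real.exp (-φ * x)) L.ν := by
    refine L.integrable_of_le_min (C := φ⁻¹ * (1 + (ε ^ 2)⁻¹))
      ((by fun_prop : Measurable fun x => x * Real.exp (-φ * x)).indicator measurableSet_Ioi)
      fun x hx => ?_
    by_cases hxε : x ∈ Ioi ε
    · rw [indicator_of_mem hxε, abs_of_nonneg (by positivity), mul_assoc]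
      have h1 := mul_exp_neg_le (x := x) hφ
      have h2 : 1 ≤ (1 + (ε ^ 2)⁻¹) * min 1 (x ^ 2) := by
        have h3 : ε ^ 2 ≤ x ^ 2 := pow_le_pow_left₀ hε.le (le_of_lt hxε) 2
        have h4 : 1 ≤ (ε ^ 2)⁻¹ * x ^ 2 := by
          rw [inv_mul_eq_div, one_le_div (by positivity)]; exact h3
        rcases min_choice 1 (x ^ 2) with h | h <;> rw [h]
        · linarith [show 0 < (ε ^ 2)⁻¹ by positivity]
        · nlinarith
      have h5 : 0 < φ⁻¹ := inv_pos.2 hφ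
      nlinarith
    · rw [indicator_of_notMem hxε, abs_zero]
      positivity
  exact ((integrable_indicator_iff measurableSet_Ioi).1 h).hasFiniteIntegral

theorem isFiniteMeasure_tiltJumpMeasure (L : LevyTriplet) {φ ε : ℝ} (hφ : 0 < φ) (hε : 0 < ε) :
    IsFiniteMeasure (L.tiltJumpMeasure φ ε) := by
  have := L.isFiniteMeasure_withDensity hφ hε
  unfold tiltJumpMeasure
  infer_instance

/-- For `x > 0`, `x - (1 - exp(-l x)) / l = x ∫_0^1 (1 - exp(-l x t)) dt`. So a jump `x`, weighted
by `x exp(-φ x)`, is spread over the points `y = exp(-x t)` with `t` uniform, for which `y ^ l =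
exp(-l x t)`. The projection `projIcc` acts trivially here. -/
theorem integral_tiltJumpMeasure (L : LevyTriplet) {φ ε l : ℝ} (hφ : 0 < φ) (hε : 0 < ε)
    (hl : 0 < l) :
    ∫ y : unitInterval, (1 - (y : ℝ) ^ l) ∂(L.tiltJumpMeasure φ ε) =
      ∫ x in Ioi ε, Real.exp (-φ * x) * (x - (1 - Real.exp (-l * x)) / l) ∂L.ν := by
  have := L.isFiniteMeasure_withDensity hφ hε
  have hcont : Continuous fun y : unitInterval => 1 - (y : ℝ) ^ l :=
    continuous_const.sub (continuous_unitInterval_rpow hl)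
  unfold tiltJumpMeasure
  rw [integral_map measurable_projIcc_exp.aemeasurable hcont.aestronglyMeasurable, integral_prod]
  rotate_left
  · refine Integrable.of_bound
      (hcont.measurable.comp measurable_projIcc_exp).aestronglyMeasurable 1
      (Eventually.of_forall fun p => ?_)
    set y := projIcc (0 : ℝ) 1 zero_le_one (Real.exp (-(p.1 * p.2)))
    have h0 := Real.rpow_nonneg y.2.1 l
    have h1 := Real.rpow_le_one y.2.1 y.2.2 hl.le
    rw [Real.norm_of_nonneg (by linarith)]
    linarith
  rw [integral_withDensity_eq_integral_toReal_smul₀ (by fun_prop)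
    (Eventually.of_forall fun x => ENNReal.ofReal_lt_top)]
  refine setIntegral_congr_fun measurableSet_Ioi fun x hx => ?_
  have hx0 : 0 < x := hε.trans hx
  have hinner : ∫ t in Icc (0 : ℝ) 1,
      (1 - (projIcc (0 : ℝ) 1 zero_le_one (Real.exp (-(x * t))) : ℝ) ^ l) =
      1 - (1 - Real.exp (-(x * l))) / (x * l) := by
    rw [← integral_one_sub_exp_neg_mul (by positivity : x * l ≠ 0),
      intervalIntegral.integral_of_le zero_le_one, ← integral_Icc_eq_integral_Ioc]
    refine setIntegral_congr_fun measurableSet_Icc fun t ht => ?_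
    have hmem : Real.exp (-(x * t)) ∈ Icc (0 : ℝ) 1 :=
      ⟨(Real.exp_pos _).le, Real.exp_le_one_iff.2 (by nlinarith [mul_nonneg hx0.le ht.1])⟩
    simp only [projIcc_of_mem _ hmem]
    rw [← Real.exp_mul]
    ring_nf
  simp only [smul_eq_mul]
  rw [hinner, ENNReal.toReal_ofReal (by positivity)]
  rw [show -l * x = -(x * l) by ring]
  field_simp

/-- The linear (Gaussian) part of `tiltJump` is a limit of ever more frequent, ever smaller jumps of
size `1 / (n + 1)`. -/
theorem tendsto_mul_one_sub_exp (l : ℝ) (hl : 0 < l) :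
    Tendsto (fun n : ℕ => ((n : ℝ) + 1) * (1 - Real.exp (-l / (n + 1)))) atTop (𝓝 l) := by
  have h0 := (tendsto_one_div_add_atTop_nhds_zero_nat (𝕜 := ℝ)).const_mul (l ^ 2)
  refine tendsto_of_tendsto_of_tendsto_of_le_of_le (by simpa using h0.const_sub l)
    (tendsto_const_nhds (x := l)) (fun n => ?_) fun n => ?_ <;>
  · have hn : (0 : ℝ) < n + 1 := by positivity
    have h1 := Real.exp_neg_sub_one_add_nonneg (l / (n + 1))
    have h2 := Real.exp_neg_sub_one_add_le_sq (show 0 ≤ l / ((n : ℝ) + 1) by positivity)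
    rw [← neg_div] at h1 h2
    have h3 := mul_nonneg hn.le h1
    have h4 := mul_le_mul_of_nonneg_left h2 hn.le
    have h5 : ((n : ℝ) + 1) * (l / (n + 1)) = l := by field_simp
    have h6 : ((n : ℝ) + 1) * (l / (n + 1)) ^ 2 = l ^ 2 * (n + 1 : ℝ)⁻¹ := by field_simp
    linarith

theorem tendsto_setIntegral_Ioi (L : LevyTriplet) {f : ℝ → ℝ} (hf : Integrable f L.ν) :
    Tendsto (fun n : ℕ => ∫ x in Ioi (1 / ((n : ℝ) + 1)), f x ∂L.ν) atTop
      (𝓝 (∫ x, f x ∂L.ν)) := by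
  have hU : ⋃ n : ℕ, Ioi (1 / ((n : ℝ) + 1)) = Ioi 0 := by
    ext x
    simp only [mem_iUnion, mem_Ioi]
    refine ⟨fun ⟨n, hn⟩ => lt_trans (by positivity) hn, fun hx => exists_nat_one_div_lt hx⟩
  have h := tendsto_setIntegral_of_monotone (μ := L.ν) (f := f)
    (s := fun n : ℕ => Ioi (1 / ((n : ℝ) + 1)))
    (fun _ => measurableSet_Ioi)
    (fun m n hmn => Ioi_subset_Ioi (one_div_le_one_div_of_le (by positivity) (by gcongr)))
    hf.integrableOn
  rw [hU] at h
  rwa [Measure.restrict_eq_self_of_ae_mem (s := Ioi 0) L.ae_pos] at h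

/-- The reciprocal of the Bernstein function `l ↦ (ψ(φ + l) - ψ(φ)) / l`. -/
theorem isMomentFunction_tilt (L : LevyTriplet) {φ d : ℝ} (hφ : 0 < φ) (hd : 0 < d) :
    IsMomentFunction fun l => d / (d + L.tiltJump φ l) := by
  let y : ℕ → unitInterval := fun n =>
    ⟨Real.exp (-1 / (n + 1)), (Real.exp_pos _).le, Real.exp_le_one_iff.2
      (div_nonpos_of_nonpos_of_nonneg (by norm_num) (by positivity))⟩
  -- Finite approximations: an atom standing for the Gaussian part, plus the jumps above `1 / (n +
  -- 1)`.
  let m : ℕ → Measure unitInterval := fun n =>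
    ENNReal.ofReal (L.σ ^ 2 / 2 * (n + 1)) • Measure.dirac (y n) +
      L.tiltJumpMeasure φ (1 / (n + 1))
  have hfin : ∀ n : ℕ, IsFiniteMeasure (L.tiltJumpMeasure φ (1 / ((n : ℝ) + 1))) := fun n =>
    L.isFiniteMeasure_tiltJumpMeasure hφ (by positivity)
  have hfin' : ∀ n : ℕ,
      IsFiniteMeasure (ENNReal.ofReal (L.σ ^ 2 / 2 * (n + 1)) • Measure.dirac (y n)) :=
    fun n => Measure.smul_finite _ ENNReal.ofReal_ne_top
  have hm : ∀ n, IsFiniteMeasure (m n) := fun n => inferInstance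
  refine IsMomentFunction.of_tendsto (fun n => IsMomentFunction.of_finite_measure (m n) hd)
    fun l hl => ?_
  refine tendsto_const_nhds.div (tendsto_const_nhds.add ?_)
    (by linarith [L.tiltJump_nonneg φ hl])
  have hint : ∀ (μ : Measure unitInterval) [IsFiniteMeasure μ],
      Integrable (fun y : unitInterval => 1 - (y : ℝ) ^ l) μ := fun μ _ =>
    (integrable_const _).sub (integrable_unitInterval_rpow μ hl)
  have hval : ∀ n : ℕ, ∫ y : unitInterval, (1 - (y : ℝ) ^ l) ∂(m n) =
      L.σ ^ 2 / 2 * ((n + 1) * (1 - Real.exp (-l / (n + 1)))) +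
        ∫ x in Ioi (1 / ((n : ℝ) + 1)),
          Real.exp (-φ * x) * (x - (1 - Real.exp (-l * x)) / l) ∂L.ν := by
    intro n
    rw [integral_add_measure (hint _) (hint _), integral_smul_measure, integral_dirac,
      L.integral_tiltJumpMeasure hφ (by positivity) hl, ENNReal.toReal_ofReal (by positivity)]
    simp only [y, smul_eq_mul]
    rw [← Real.exp_mul, show -1 / ((n : ℝ) + 1) * l = -l / (n + 1) by ring]
    ring
  simp_rw [hval]
  exact ((tendsto_mul_one_sub_exp l hl).const_mul _).add
    (L.tendsto_setIntegral_Ioi (L.integrable_tiltJump hφ hl))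

end LevyTriplet

/-! ### From moment functions to the scale function -/

/-- The distribution function of the sub-probability measure on `[0, ∞)` encoded by a probability
measure on `[0, 1]`. -/
def momentCdf (P : ProbabilityMeasure unitInterval) (x : ℝ) : ℝ :=
  (P : Measure unitInterval).real {y | Real.exp (-x) ≤ y}

theorem momentCdf_mono (P : ProbabilityMeasure unitInterval) : Monotone (momentCdf P) :=
  fun _ _ h => measureReal_mono fun _ hy =>
    le_trans (Real.exp_le_exp.2 (neg_le_neg h)) hy

theorem momentCdf_of_neg (P : ProbabilityMeasure unitInterval) {x : ℝ} (hx : x < 0) :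
    momentCdf P x = 0 := by
  have : {y : unitInterval | Real.exp (-x) ≤ y} = ∅ := by
    ext y
    simp only [mem_ofPred_eq, mem_empty_iff_false, iff_false, not_le]
    exact lt_of_le_of_lt y.2.2 (Real.one_lt_exp_iff.2 (by linarith))
  simp [momentCdf, this]

theorem momentCdf_eq_cdf (P : ProbabilityMeasure unitInterval) (x : ℝ) :
    momentCdf P x = ProbabilityTheory.cdf
      ((P : Measure unitInterval).map fun y : unitInterval => -(y : ℝ)) (-Real.exp (-x)) := by
  have hm : Measurable fun y : unitInterval => -(y : ℝ) := by fun_prop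
  have : IsProbabilityMeasure ((P : Measure unitInterval).map fun y : unitInterval => -(y : ℝ)) :=
    Measure.isProbabilityMeasure_map hm.aemeasurable
  rw [momentCdf, ProbabilityTheory.cdf_eq_real, map_measureReal_apply hm measurableSet_Iic]
  congr 1
  ext y
  simp

theorem momentCdf_right_continuous (P : ProbabilityMeasure unitInterval) (x : ℝ) :
    ContinuousWithinAt (momentCdf P) (Ici x) x := by
  have h : momentCdf P = fun x => _ := funext (momentCdf_eq_cdf P)
  rw [h]
  refine ContinuousWithinAt.comp (t := Ici (-Real.exp (-x)))
    (StieltjesFunction.right_continuous _ _)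
    (by fun_prop : Continuous fun x : ℝ => -Real.exp (-x)).continuousWithinAt fun z hz => ?_
  exact neg_le_neg (Real.exp_le_exp.2 (neg_le_neg hz))

theorem integral_indicator_exp {l : ℝ} (hl : 0 < l) (y : unitInterval) :
    ∫ x in Ioi (0 : ℝ), (if Real.exp (-x) ≤ y then Real.exp (-l * x) else 0) =
      (y : ℝ) ^ l / l := by
  -- The point `y = 0` represents mass at infinity: it never enters the distribution function, and
  -- both sides vanish.
  rcases eq_or_lt_of_le y.2.1 with hy | hy
  · have : ∀ x : ℝ, ¬ Real.exp (-x) ≤ (y : ℝ) := fun x => by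
      rw [← hy]; exact not_le.2 (Real.exp_pos _)
    simp only [if_neg (this _), integral_zero]
    rw [← hy, Real.zero_rpow hl.ne', zero_div]
  · have hlog : Real.log y ≤ 0 := Real.log_nonpos y.2.1 y.2.2
    have h1 : ∀ x : ℝ, (if Real.exp (-x) ≤ (y : ℝ) then Real.exp (-l * x) else 0) =
        (Ici (-Real.log y)).indicator (fun x => Real.exp (-l * x)) x := fun x => by
      have : Real.exp (-x) ≤ (y : ℝ) ↔ x ∈ Ici (-Real.log y) := by
        rw [← Real.le_log_iff_exp_le hy, mem_Ici]
        constructor <;> intro h <;> linarith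
      by_cases hx : x ∈ Ici (-Real.log y)
      · rw [if_pos (this.2 hx), indicator_of_mem hx]
      · rw [if_neg (fun h => hx (this.1 h)), indicator_of_notMem hx]
    simp_rw [h1]
    rw [← integral_Ici_eq_integral_Ioi, setIntegral_indicator measurableSet_Ici,
      inter_eq_self_of_subset_right (Ici_subset_Ici.2 (by linarith)),
      integral_Ici_eq_integral_Ioi, integral_exp_mul_Ioi (by linarith)]
    rw [Real.rpow_def_of_pos hy, neg_div_neg_eq]
    ring_nf

theorem integrableOn_and_integral_momentCdf (P : ProbabilityMeasure unitInterval) {l : ℝ}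
    (hl : 0 < l) :
    IntegrableOn (fun x => Real.exp (-l * x) * momentCdf P x) (Ioi 0) ∧
      ∫ x in Ioi (0 : ℝ), Real.exp (-l * x) * momentCdf P x =
        (∫ y : unitInterval, (y : ℝ) ^ l ∂(P : Measure unitInterval)) / l := by
  let f : ℝ × unitInterval → ℝ := fun p =>
    if Real.exp (-p.1) ≤ p.2 then Real.exp (-l * p.1) else 0
  have hfm : Measurable f :=
    Measurable.ite (measurableSet_le (by fun_prop) (by fun_prop)) (by fun_prop) (by fun_prop)
  have hexp : Integrable (fun x : ℝ => Real.exp (-l * x)) (volume.restrict (Ioi 0)) :=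
    integrableOn_exp_mul_Ioi (by linarith) 0
  have hfi : Integrable f ((volume.restrict (Ioi 0)).prod (P : Measure unitInterval)) := by
    refine (hexp.comp_fst (P : Measure unitInterval)).mono' hfm.aestronglyMeasurable
      (Eventually.of_forall fun p => ?_)
    simp only [f]
    split_ifs
    · rw [Real.norm_of_nonneg (Real.exp_pos _).le]
    · simpa using (Real.exp_pos _).le
  have hinner : ∀ x, ∫ y, f (x, y) ∂(P : Measure unitInterval) =
      Real.exp (-l * x) * momentCdf P x := fun x => by
    have hS : MeasurableSet {y : unitInterval | Real.exp (-x) ≤ y} :=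
      measurableSet_le (by fun_prop) (by fun_prop)
    have : (fun y => f (x, y)) =
        {y : unitInterval | Real.exp (-x) ≤ y}.indicator fun _ => Real.exp (-l * x) := by
      ext y
      simp [f, indicator]
    rw [this, integral_indicator_const _ hS, smul_eq_mul, mul_comm, momentCdf]
  constructor
  · refine hfi.integral_prod_left.congr (Eventually.of_forall fun x => hinner x)
  · rw [← integral_congr_ae (Eventually.of_forall fun x => hinner x),
      integral_integral_swap (f := fun x y => f (x, y)) hfi, ← integral_div]
    exact integral_congr_ae (Eventually.of_forall fun y => integral_indicator_exp hl y)

namespace LevyTriplet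

/-- Existence of the `q`-scale function. -/
theorem exists_isScaleFunction (L : LevyTriplet) (hL : L.NotSubordinator) {q : ℝ} (hq : 0 < q) :
    ∃ W, IsScaleFunction L.psiY q W := by
  obtain ⟨φ, hφ, hψ⟩ := L.exists_psiY_eq hL hq
  set d := L.tiltDrift φ with hd
  have hd0 : 0 < d := by
    have := L.psiY_le_mul_tiltDrift hφ
    by_contra! hc
    nlinarith
  obtain ⟨P, hP⟩ := L.isMomentFunction_tilt hφ hd0
  have hnn : ∀ x, 0 ≤ momentCdf P x := fun x => measureReal_nonneg
  -- With `f = d / (d + J)`, `1 / (ψ(φ + l) - q) = f(l) / (d l)`, and `f(l) / l` is the Laplace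
  -- transform of `momentCdf P`; the factor `exp(φ x)` shifts the argument back from `l` to `θ = φ +
  -- l`.
  refine ⟨fun x => Real.exp (φ * x) * momentCdf P x / d, ?_, ?_, ?_, ?_, ?_⟩
  · intro x
    have := hnn x
    positivity
  · intro x hx
    simp [momentCdf_of_neg P hx]
  · intro x _ y _ hxy
    have := hnn x
    have := momentCdf_mono P hxy
    dsimp only
    gcongr
  · intro x _
    exact ((by fun_prop : Continuous fun x : ℝ => Real.exp (φ * x)).continuousWithinAt.mul
      (momentCdf_right_continuous P x)).div_const d
  · intro θ hθ
    rw [L.rightInverse_eq hq hφ hψ] at hθ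
    have hl : 0 < θ - φ := sub_pos.2 hθ
    have heq : (fun x => Real.exp (-θ * x) * (Real.exp (φ * x) * momentCdf P x / d)) =
        fun x => Real.exp (-(θ - φ) * x) * momentCdf P x / d := by
      ext x
      rw [← mul_div_assoc, ← mul_assoc, ← Real.exp_add]
      ring_nf
    obtain ⟨h1, h2⟩ := integrableOn_and_integral_momentCdf P hl
    rw [heq]
    refine ⟨h1.div_const d, ?_⟩
    rw [integral_div, h2, ← hP _ hl]
    have h3 := L.psiY_add hφ hl
    rw [add_sub_cancel, hψ, ← hd] at h3
    rw [h3]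
    have := L.tiltJump_nonneg φ hl
    field_simp

end LevyTriplet

/-! ### Monotonicity and positivity of scale functions -/

namespace IsScaleFunction

theorem monotone {ψ : ℝ → ℝ} {q : ℝ} {W : ℝ → ℝ} (h : IsScaleFunction ψ q W) : Monotone W := by
  intro x y hxy
  rcases lt_or_ge x 0 with hx | hx
  · rw [h.zero_of_neg x hx]
    exact h.nonneg y
  · exact h.mono hx (hx.trans hxy) hxy

/-- If `W x = 0` then `W` vanishes on `(-∞, x]`, so its transform is `O(exp(-θ x))`. But the
transform is `1 / (ψ(θ) - q)`, at least of order `θ⁻²` by `exists_psiY_le_sq`. -/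
theorem pos {L : LevyTriplet} (hL : L.NotSubordinator) {q : ℝ} (hq : 0 < q) {W : ℝ → ℝ}
    (h : IsScaleFunction L.psiY q W) {x : ℝ} (hx : 0 < x) : 0 < W x := by
  refine lt_of_le_of_ne (h.nonneg x) fun hW => ?_
  obtain ⟨φ, hφ, hψ⟩ := L.exists_psiY_eq hL hq
  have hR := L.rightInverse_eq hq hφ hψ
  obtain ⟨C, hC⟩ := L.exists_psiY_le_sq
  set θ₀ := φ + 1 with hθ₀
  obtain ⟨i0, e0⟩ := h.laplace θ₀ (by rw [hR]; linarith)
  set A := ∫ y in Ioi (0 : ℝ), Real.exp (-θ₀ * y) * W y with hA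
  have key : ∀ θ ≥ θ₀, 1 ≤ A * Real.exp (θ₀ * x) * C * (θ ^ (2 : ℝ) * Real.exp (-x * θ)) := by
    intro θ hθ
    obtain ⟨i1, e1⟩ := h.laplace θ (by rw [hR]; linarith)
    have hle : ∫ y in Ioi (0 : ℝ), Real.exp (-θ * y) * W y ≤
        Real.exp (-(θ - θ₀) * x) * A := by
      rw [hA, ← integral_const_mul]
      refine integral_mono i1 (i0.const_mul _) fun y => ?_
      dsimp only
      rcases le_or_gt y x with hy | hy
      · have : W y = 0 := le_antisymm (by rw [hW]; exact h.monotone hy) (h.nonneg y)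
        simp [this]
      · rw [← mul_assoc, ← Real.exp_add]
        refine mul_le_mul_of_nonneg_right (Real.exp_le_exp.2 ?_) (h.nonneg y)
        nlinarith
    have hpos : 0 < L.psiY θ - q := sub_pos.2 (L.lt_psiY_of_lt hq hφ hψ (by linarith))
    have hub : L.psiY θ - q ≤ C * θ ^ 2 := by linarith [hC θ (by linarith)]
    have hA0 : 0 ≤ A := integral_nonneg fun y => mul_nonneg (Real.exp_pos _).le (h.nonneg y)
    rw [e1, div_le_iff₀ hpos] at hle
    refine hle.trans ((mul_le_mul_of_nonneg_left hub (by positivity)).trans (le_of_eq ?_))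
    rw [Real.rpow_two, show -(θ - θ₀) * x = θ₀ * x + -x * θ by ring, Real.exp_add]
    ring
  have hlim := (tendsto_rpow_mul_exp_neg_mul_atTop_nhds_zero 2 x hx).const_mul
    (A * Real.exp (θ₀ * x) * C)
  rw [mul_zero] at hlim
  have : (1 : ℝ) ≤ 0 := ge_of_tendsto hlim ((eventually_ge_atTop θ₀).mono key)
  linarith

end IsScaleFunction

/-! ### The functions `Z` and `Z̄` -/

section Z

variable {ψ : ℝ → ℝ} {q : ℝ}

theorem scaleZ_zero : scaleZ ψ q 0 = 1 := by simp [scaleZ]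

theorem scaleZ_of_nonpos (h : IsScaleFunction ψ q (scaleFunction ψ q)) {x : ℝ} (hx : x ≤ 0) :
    scaleZ ψ q x = 1 := by
  have : ∫ y in x..(0 : ℝ), scaleFunction ψ q y = 0 := by
    rw [intervalIntegral.integral_of_le hx, integral_Ioc_eq_integral_Ioo,
      setIntegral_congr_fun measurableSet_Ioo fun y hy => h.zero_of_neg y hy.2]
    simp
  rw [scaleZ, intervalIntegral.integral_symm, this]
  simp

theorem continuous_scaleZ (h : IsScaleFunction ψ q (scaleFunction ψ q)) :
    Continuous (scaleZ ψ q) :=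
  continuous_const.add (continuous_const.mul
    (intervalIntegral.continuous_primitive (fun _ _ => h.monotone.intervalIntegrable) 0))

theorem scaleZ_sub (h : IsScaleFunction ψ q (scaleFunction ψ q)) (x y : ℝ) :
    scaleZ ψ q y - scaleZ ψ q x = q * ∫ u in x..y, scaleFunction ψ q u := by
  have : (∫ u in (0 : ℝ)..y, scaleFunction ψ q u) - ∫ u in (0 : ℝ)..x, scaleFunction ψ q u =
      ∫ u in x..y, scaleFunction ψ q u :=
    intervalIntegral.integral_interval_sub_left
      h.monotone.intervalIntegrable h.monotone.intervalIntegrable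
  rw [scaleZ, scaleZ, ← this]
  ring

theorem mul_le_scaleZ_sub (h : IsScaleFunction ψ q (scaleFunction ψ q)) (hq : 0 < q) {x y : ℝ}
    (hxy : x ≤ y) : q * (scaleFunction ψ q x * (y - x)) ≤ scaleZ ψ q y - scaleZ ψ q x := by
  rw [scaleZ_sub h]
  refine mul_le_mul_of_nonneg_left ?_ hq.le
  have := intervalIntegral.integral_mono_on hxy
    (intervalIntegrable_const (c := scaleFunction ψ q x) (μ := volume))
    h.monotone.intervalIntegrable fun u hu => h.monotone hu.1
  simpa [mul_comm] using this

theorem monotone_scaleZ (h : IsScaleFunction ψ q (scaleFunction ψ q)) (hq : 0 < q) :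
    Monotone (scaleZ ψ q) := fun x y hxy => by
  have := mul_le_scaleZ_sub h hq hxy
  have := mul_nonneg hq.le (mul_nonneg (h.nonneg x) (sub_nonneg.2 hxy))
  linarith

theorem one_le_scaleZ (h : IsScaleFunction ψ q (scaleFunction ψ q)) (hq : 0 < q) (x : ℝ) :
    1 ≤ scaleZ ψ q x := by
  rcases le_total x 0 with hx | hx
  · rw [scaleZ_of_nonpos h hx]
  · rw [← scaleZ_zero (ψ := ψ) (q := q)]
    exact monotone_scaleZ h hq hx

theorem strictMonoOn_scaleZ (h : IsScaleFunction ψ q (scaleFunction ψ q)) (hq : 0 < q)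
    (hpos : ∀ x > 0, 0 < scaleFunction ψ q x) : StrictMonoOn (scaleZ ψ q) (Ici 0) := by
  intro x hx y _ hxy
  have hm : x < (x + y) / 2 := by linarith
  have h1 := monotone_scaleZ h hq hm.le
  have h2 := mul_le_scaleZ_sub h hq (by linarith : (x + y) / 2 ≤ y)
  have h3 : 0 < q * (scaleFunction ψ q ((x + y) / 2) * (y - (x + y) / 2)) :=
    mul_pos hq (mul_pos (hpos _ (lt_of_le_of_lt hx hm)) (by linarith))
  linarith

theorem exists_scaleZ_eq (h : IsScaleFunction ψ q (scaleFunction ψ q)) (hq : 0 < q)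
    (hpos : ∀ x > 0, 0 < scaleFunction ψ q x) {c : ℝ} (hc : 1 < c) :
    ∃ k > 0, scaleZ ψ q k = c := by
  have hw := hpos 1 one_pos
  -- Beyond `1`, `Z` grows at rate at least `q W(1)`, so a further `c / (q W(1))` brings it above
  -- `c`.
  set N := 1 + c / (q * scaleFunction ψ q 1) with hN
  have h1N : 1 ≤ N := by
    rw [hN]; linarith [show 0 < c / (q * scaleFunction ψ q 1) by positivity]
  have hle : c ≤ scaleZ ψ q N := by
    have h1 := mul_le_scaleZ_sub h hq h1N
    have h2 : q * (scaleFunction ψ q 1 * (N - 1)) = c := by rw [hN]; field_simp; ring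
    linarith [one_le_scaleZ h hq 1]
  obtain ⟨k, hk, hkc⟩ := intermediate_value_Icc (by linarith : (0 : ℝ) ≤ N)
    (continuous_scaleZ h).continuousOn ⟨by rw [scaleZ_zero]; exact hc.le, hle⟩
  refine ⟨k, lt_of_le_of_ne hk.1 ?_, hkc⟩
  rintro rfl
  rw [scaleZ_zero] at hkc
  linarith

theorem scaleZbar_zero : scaleZbar ψ q 0 = 0 := by simp [scaleZbar]

theorem continuous_scaleZbar (h : IsScaleFunction ψ q (scaleFunction ψ q)) :
    Continuous (scaleZbar ψ q) :=
  intervalIntegral.continuous_primitive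
    (fun _ _ => (continuous_scaleZ h).intervalIntegrable _ _) 0

theorem sub_le_scaleZbar_sub (h : IsScaleFunction ψ q (scaleFunction ψ q)) (hq : 0 < q) {x y : ℝ}
    (hxy : x ≤ y) : y - x ≤ scaleZbar ψ q y - scaleZbar ψ q x := by
  have hi : ∀ a b, IntervalIntegrable (scaleZ ψ q) volume a b := fun a b =>
    (continuous_scaleZ h).intervalIntegrable a b
  rw [scaleZbar, scaleZbar, intervalIntegral.integral_interval_sub_left (hi _ _) (hi _ _)]
  have := intervalIntegral.integral_mono_on hxy
    (intervalIntegrable_const (c := (1 : ℝ)) (μ := volume)) (hi x y)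
    fun u _ => one_le_scaleZ h hq u
  simpa using this

/-- Strict on the whole line, since `Z ≥ 1` also at negative arguments; hence `Z̄` takes each value
at most once among all reals. -/
theorem strictMono_scaleZbar (h : IsScaleFunction ψ q (scaleFunction ψ q)) (hq : 0 < q) :
    StrictMono (scaleZbar ψ q) := fun x y hxy => by
  linarith [sub_le_scaleZbar_sub h hq hxy.le]

theorem le_scaleZbar (h : IsScaleFunction ψ q (scaleFunction ψ q)) (hq : 0 < q) {x : ℝ}
    (hx : 0 ≤ x) : x ≤ scaleZbar ψ q x := by
  simpa [scaleZbar_zero] using sub_le_scaleZbar_sub h hq hx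

theorem scaleZbar_le_mul (h : IsScaleFunction ψ q (scaleFunction ψ q)) (hq : 0 < q) {x : ℝ}
    (hx : 0 ≤ x) : scaleZbar ψ q x ≤ x * scaleZ ψ q x := by
  have := intervalIntegral.integral_mono_on hx ((continuous_scaleZ h).intervalIntegrable 0 x)
    (intervalIntegrable_const (c := scaleZ ψ q x) (μ := volume))
    fun u hu => monotone_scaleZ h hq hu.2
  simpa [scaleZbar] using this

theorem exists_scaleZbar_eq (h : IsScaleFunction ψ q (scaleFunction ψ q)) (hq : 0 < q) {c : ℝ}
    (hc : 0 < c) : ∃ b > 0, scaleZbar ψ q b = c := by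
  obtain ⟨b, hb, hbc⟩ := intermediate_value_Icc hc.le (continuous_scaleZbar h).continuousOn
    ⟨by rw [scaleZbar_zero]; exact hc.le, le_scaleZbar h hq hc.le⟩
  refine ⟨b, lt_of_le_of_ne hb.1 ?_, hbc⟩
  rintro rfl
  rw [scaleZbar_zero] at hbc
  linarith

end Z

/-! ### Transfer from `Y` to `X`, and the value `Γ(0,0)` -/

namespace LevyTriplet

/-- The triplet of `Y_t - δ t`. -/
def addDrift (L : LevyTriplet) (δ : ℝ) : LevyTriplet := { L with γ := L.γ + δ }

theorem psiY_addDrift (L : LevyTriplet) (δ : ℝ) : (L.addDrift δ).psiY = L.psiX δ := by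
  ext θ
  simp only [psiY, addDrift, psiX]
  ring

theorem NotSubordinator.addDrift {L : LevyTriplet} (hL : L.NotSubordinator) {δ : ℝ}
    (hδ : 0 < δ) : (L.addDrift δ).NotSubordinator := by
  rcases hL with h | h | h
  · exact Or.inl h
  · exact Or.inr (Or.inl h)
  · refine Or.inr (Or.inr ?_)
    simp only [LevyTriplet.addDrift]
    linarith

theorem isScaleFunction_psiY (L : LevyTriplet) (hL : L.NotSubordinator) {q : ℝ} (hq : 0 < q) :
    IsScaleFunction L.psiY q (scaleFunction L.psiY q) :=
  Classical.epsilon_spec (L.exists_isScaleFunction hL hq)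

theorem isScaleFunction_psiX (L : LevyTriplet) (hL : L.NotSubordinator) {q δ : ℝ} (hq : 0 < q)
    (hδ : 0 < δ) : IsScaleFunction (L.psiX δ) q (scaleFunction (L.psiX δ) q) := by
  rw [← psiY_addDrift]
  exact isScaleFunction_psiY _ (hL.addDrift hδ) hq

theorem scaleFunction_psiX_pos (L : LevyTriplet) (hL : L.NotSubordinator) {q δ : ℝ} (hq : 0 < q)
    (hδ : 0 < δ) : ∀ x > 0, 0 < scaleFunction (L.psiX δ) q x := by
  rw [← psiY_addDrift]
  exact fun x hx => (isScaleFunction_psiY _ (hL.addDrift hδ) hq).pos (hL.addDrift hδ) hq hx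

theorem rightDerivZero_psiX (L : LevyTriplet) (hmean : DifferentiableWithinAt ℝ L.psiY (Ici 0) 0)
    (δ : ℝ) : rightDerivZero (L.psiX δ) = rightDerivZero L.psiY + δ := by
  have h2 : HasDerivWithinAt (fun θ : ℝ => δ * θ) δ (Ici 0) 0 := by
    simpa using (hasDerivWithinAt_id (0 : ℝ) (Ici 0)).const_mul δ
  exact (hmean.hasDerivWithinAt.add h2).derivWithin (uniqueDiffWithinAt_Ici 0)

theorem bigGamma_zero_zero (L : LevyTriplet) {q : ℝ} (hq : 0 < q) (ρ δ β : ℝ) :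
    L.bigGamma q ρ δ β 0 0 = δ - q * ρ - β * rightDerivZero (L.psiX δ) := by
  simp only [bigGamma, rTilde, scaleZ_zero, scaleZbar_zero, sub_zero,
    intervalIntegral.integral_same]
  field_simp
  ring

end LevyTriplet

/-! ### Reduction to one variable and characterization of the levels -/

namespace LevyTriplet

theorem intervalIntegrable_scaleFunction_mul {L : LevyTriplet} (hL : L.NotSubordinator) {q : ℝ}
    (hq : 0 < q) {g : ℝ → ℝ} (hg : Continuous g) (a b : ℝ) :
    IntervalIntegrable (fun u => scaleFunction L.psiY q u * g u) volume a b :=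
  (L.isScaleFunction_psiY hL hq).monotone.intervalIntegrable.mul_continuousOn hg.continuousOn

/-- The substitution `u = b - y`, combined with `Z_Y(a) = 1 + q ∫_0^a W_Y`, gathers all dependence
on `a` into one integral whose integrand has the sign of `γ(u, b)` wherever `W_Y(u) > 0`. -/
theorem bigGamma_eq {L : LevyTriplet} (hL : L.NotSubordinator) {q δ : ℝ} (hq : 0 < q)
    (hδ : 0 < δ) (ρ β a b : ℝ) :
    L.bigGamma q ρ δ β a b = L.bigGamma q ρ δ β 0 0 - q * β * scaleZbar (L.psiX δ) q b +
      q * δ * ∫ u in (0 : ℝ)..a,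
        scaleFunction L.psiY q u * (1 - β * scaleZ (L.psiX δ) q (b - u)) := by
  have hZ := continuous_scaleZ (L.isScaleFunction_psiX hL hq hδ)
  have hZb : Continuous fun u => scaleZ (L.psiX δ) q (b - u) := by fun_prop
  have h1 : ∫ y in (b - a)..b, scaleFunction L.psiY q (b - y) * scaleZ (L.psiX δ) q y =
      ∫ u in (0 : ℝ)..a, scaleFunction L.psiY q u * scaleZ (L.psiX δ) q (b - u) := by
    have := intervalIntegral.integral_comp_sub_left (a := b - a) (b := b)
      (fun u => scaleFunction L.psiY q u * scaleZ (L.psiX δ) q (b - u)) b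
    simpa using this
  have h2 : ∫ u in (0 : ℝ)..a, scaleFunction L.psiY q u * (1 - β * scaleZ (L.psiX δ) q (b - u)) =
      (∫ u in (0 : ℝ)..a, scaleFunction L.psiY q u) -
        β * ∫ u in (0 : ℝ)..a, scaleFunction L.psiY q u * scaleZ (L.psiX δ) q (b - u) := by
    rw [← intervalIntegral.integral_const_mul, ← intervalIntegral.integral_sub
      (L.isScaleFunction_psiY hL hq).monotone.intervalIntegrable
      ((intervalIntegrable_scaleFunction_mul hL hq hZb 0 a).const_mul β)]
    refine intervalIntegral.integral_congr fun u _ => ?_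
    ring
  rw [bigGamma_zero_zero L hq, bigGamma, rTilde, h1, h2, scaleZ]
  field_simp
  ring

theorem bigGamma_zero_left {L : LevyTriplet} (hL : L.NotSubordinator) {q δ : ℝ} (hq : 0 < q)
    (hδ : 0 < δ) (ρ β b : ℝ) :
    L.bigGamma q ρ δ β 0 b = L.bigGamma q ρ δ β 0 0 - q * β * scaleZbar (L.psiX δ) q b := by
  rw [bigGamma_eq hL hq hδ]
  simp

/-- `(β Z_X(x) - 1)⁺`. -/
def excess (L : LevyTriplet) (q δ β x : ℝ) : ℝ := max 0 (β * scaleZ (L.psiX δ) q x - 1)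

theorem excess_nonneg (L : LevyTriplet) (q δ β x : ℝ) : 0 ≤ L.excess q δ β x := le_max_left _ _

theorem continuous_excess {L : LevyTriplet} (hL : L.NotSubordinator) {q δ : ℝ} (hq : 0 < q)
    (hδ : 0 < δ) (β : ℝ) : Continuous (L.excess q δ β) := by
  have := continuous_scaleZ (L.isScaleFunction_psiX hL hq hδ)
  unfold excess
  fun_prop

theorem monotone_excess {L : LevyTriplet} (hL : L.NotSubordinator) {q δ : ℝ} (hq : 0 < q)
    (hδ : 0 < δ) {β : ℝ} (hβ : 0 < β) : Monotone (L.excess q δ β) := fun x y hxy => by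
  have := monotone_scaleZ (L.isScaleFunction_psiX hL hq hδ) hq hxy
  unfold excess
  gcongr

theorem excess_eq_zero {L : LevyTriplet} {q δ β x : ℝ} (hβ : 0 < β)
    (h : scaleZ (L.psiX δ) q x ≤ β⁻¹) : L.excess q δ β x = 0 := by
  refine max_eq_left ?_
  have := mul_le_mul_of_nonneg_left h hβ.le
  rw [mul_inv_cancel₀ hβ.ne'] at this
  linarith

theorem excess_eq_sub {L : LevyTriplet} {q δ β x : ℝ} (hβ : 0 < β)
    (h : β⁻¹ ≤ scaleZ (L.psiX δ) q x) : L.excess q δ β x = β * scaleZ (L.psiX δ) q x - 1 := by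
  refine max_eq_right ?_
  have := mul_le_mul_of_nonneg_left h hβ.le
  rw [mul_inv_cancel₀ hβ.ne'] at this
  linarith

/-- `min_{0 ≤ a ≤ b} Γ(a, b)`, as a function of `b`. -/
def minGamma (L : LevyTriplet) (q ρ δ β b : ℝ) : ℝ :=
  L.bigGamma q ρ δ β 0 0 - q * β * scaleZbar (L.psiX δ) q b -
    q * δ * ∫ u in (0 : ℝ)..b, scaleFunction L.psiY q u * L.excess q δ β (b - u)

/-- The excess vanishes once `Z_X(b - u) ≤ 1/β`, so the upper limit may be moved freely past that
point. This gives different values of `b` a common range of integration. -/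
theorem integral_excess_extend {L : LevyTriplet} (hL : L.NotSubordinator) {q δ : ℝ} (hq : 0 < q)
    (hδ : 0 < δ) {β : ℝ} (hβ : β ∈ Ioo (0 : ℝ) 1) {a b c : ℝ} (hac : a ≤ c)
    (h : scaleZ (L.psiX δ) q (b - a) ≤ β⁻¹) :
    ∫ u in (0 : ℝ)..a, scaleFunction L.psiY q u * L.excess q δ β (b - u) =
      ∫ u in (0 : ℝ)..c, scaleFunction L.psiY q u * L.excess q δ β (b - u) := by
  have hc := continuous_excess hL hq hδ β
  have hi := fun a c => intervalIntegrable_scaleFunction_mul hL hq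
    (by fun_prop : Continuous fun u => L.excess q δ β (b - u)) a c
  have h0 : ∫ u in a..c, scaleFunction L.psiY q u * L.excess q δ β (b - u) = 0 := by
    rw [intervalIntegral.integral_congr (g := fun _ => 0)]
    · simp
    · intro u hu
      rw [uIcc_of_le hac] at hu
      have := monotone_scaleZ (L.isScaleFunction_psiX hL hq hδ) hq
        (by linarith [hu.1] : b - u ≤ b - a)
      simp [excess_eq_zero hβ.1 (this.trans h)]
  rw [← intervalIntegral.integral_add_adjacent_intervals (hi 0 a) (hi a c), h0, add_zero]

theorem scaleZ_le_inv_of_nonpos {L : LevyTriplet} (hL : L.NotSubordinator) {q δ : ℝ} (hq : 0 < q)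
    (hδ : 0 < δ) {β : ℝ} (hβ : β ∈ Ioo (0 : ℝ) 1) {x : ℝ} (hx : x ≤ 0) :
    scaleZ (L.psiX δ) q x ≤ β⁻¹ := by
  rw [scaleZ_of_nonpos (L.isScaleFunction_psiX hL hq hδ) hx]
  exact (one_lt_inv₀ hβ.1).2 hβ.2 |>.le

theorem bigGamma_max_eq_minGamma {L : LevyTriplet} (hL : L.NotSubordinator) {q δ : ℝ} (hq : 0 < q)
    (hδ : 0 < δ) (ρ : ℝ) {β : ℝ} (hβ : β ∈ Ioo (0 : ℝ) 1) {k b : ℝ} (hk : 0 ≤ k)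
    (hkZ : scaleZ (L.psiX δ) q k = β⁻¹) (hb : 0 ≤ b) :
    L.bigGamma q ρ δ β (max 0 (b - k)) b = L.minGamma q ρ δ β b := by
  have hmono := monotone_scaleZ (L.isScaleFunction_psiX hL hq hδ) hq
  rw [bigGamma_eq hL hq hδ, minGamma, ← integral_excess_extend hL hq hδ hβ
    (max_le hb (by linarith) : max 0 (b - k) ≤ b)
    (by rw [← hkZ]; exact hmono (by linarith [le_max_right 0 (b - k)]))]
  have : ∫ u in (0 : ℝ)..max 0 (b - k),
      scaleFunction L.psiY q u * (1 - β * scaleZ (L.psiX δ) q (b - u)) =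
      -∫ u in (0 : ℝ)..max 0 (b - k), scaleFunction L.psiY q u * L.excess q δ β (b - u) := by
    rcases le_total (b - k) 0 with hbk | hbk
    · simp [max_eq_left hbk]
    · rw [← intervalIntegral.integral_neg]
      refine intervalIntegral.integral_congr fun u hu => ?_
      rw [max_eq_right hbk, uIcc_of_le hbk] at hu
      have hZ : β⁻¹ ≤ scaleZ (L.psiX δ) q (b - u) := by
        rw [← hkZ]; exact hmono (by linarith [hu.2])
      simp only [excess_eq_sub hβ.1 hZ]
      ring
  rw [this]
  ring

theorem minGamma_zero (L : LevyTriplet) (q ρ δ β : ℝ) :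
    L.minGamma q ρ δ β 0 = L.bigGamma q ρ δ β 0 0 := by
  simp [minGamma, scaleZbar_zero]

theorem minGamma_of_scaleZ_le {L : LevyTriplet} (hL : L.NotSubordinator) {q δ : ℝ} (hq : 0 < q)
    (hδ : 0 < δ) (ρ : ℝ) {β : ℝ} (hβ : β ∈ Ioo (0 : ℝ) 1) {b : ℝ} (hb : 0 ≤ b)
    (hZ : scaleZ (L.psiX δ) q b ≤ β⁻¹) :
    L.minGamma q ρ δ β b = L.bigGamma q ρ δ β 0 0 - q * β * scaleZbar (L.psiX δ) q b := by
  rw [minGamma, ← integral_excess_extend hL hq hδ hβ hb (by simpa using hZ)]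
  simp

theorem minGamma_le {L : LevyTriplet} (hL : L.NotSubordinator) {q δ : ℝ} (hq : 0 < q)
    (hδ : 0 < δ) (ρ β : ℝ) {b : ℝ} (hb : 0 ≤ b) :
    L.minGamma q ρ δ β b ≤ L.bigGamma q ρ δ β 0 0 - q * β * scaleZbar (L.psiX δ) q b := by
  have : 0 ≤ ∫ u in (0 : ℝ)..b, scaleFunction L.psiY q u * L.excess q δ β (b - u) :=
    intervalIntegral.integral_nonneg hb fun u _ =>
      mul_nonneg ((L.isScaleFunction_psiY hL hq).nonneg u) (L.excess_nonneg _ _ _ _)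
  have := mul_nonneg (mul_nonneg hq.le hδ.le) this
  rw [minGamma]
  linarith

/-- Over a common range the integral is nondecreasing in `b`; strictness comes from `Z̄_X`. -/
theorem strictAntiOn_minGamma {L : LevyTriplet} (hL : L.NotSubordinator) {q δ : ℝ} (hq : 0 < q)
    (hδ : 0 < δ) (ρ : ℝ) {β : ℝ} (hβ : β ∈ Ioo (0 : ℝ) 1) :
    StrictAntiOn (L.minGamma q ρ δ β) (Ici 0) := by
  intro b hb b' hb' hbb'
  have hc := continuous_excess hL hq hδ β
  have h1 := strictMono_scaleZbar (L.isScaleFunction_psiX hL hq hδ) hq hbb'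
  have h2 : ∫ u in (0 : ℝ)..b', scaleFunction L.psiY q u * L.excess q δ β (b - u) ≤
      ∫ u in (0 : ℝ)..b', scaleFunction L.psiY q u * L.excess q δ β (b' - u) := by
    refine intervalIntegral.integral_mono_on hb'
      (intervalIntegrable_scaleFunction_mul hL hq (by fun_prop) _ _)
      (intervalIntegrable_scaleFunction_mul hL hq (by fun_prop) _ _) fun u _ => ?_
    exact mul_le_mul_of_nonneg_left (monotone_excess hL hq hδ hβ.1 (by linarith))
      ((L.isScaleFunction_psiY hL hq).nonneg u)
  rw [minGamma, minGamma, integral_excess_extend hL hq hδ hβ hbb'.le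
    (scaleZ_le_inv_of_nonpos hL hq hδ hβ (by linarith))]
  have h3 := mul_le_mul_of_nonneg_left h2 (mul_nonneg hq.le hδ.le)
  have h4 := mul_lt_mul_of_pos_left h1 (mul_pos hq hβ.1)
  linarith

theorem continuousOn_minGamma {L : LevyTriplet} (hL : L.NotSubordinator) {q δ : ℝ} (hq : 0 < q)
    (hδ : 0 < δ) (ρ : ℝ) {β : ℝ} (hβ : β ∈ Ioo (0 : ℝ) 1) (N : ℝ) :
    ContinuousOn (L.minGamma q ρ δ β) (Icc 0 N) := by
  have hc := continuous_excess hL hq hδ β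
  have hZ := continuous_scaleZbar (L.isScaleFunction_psiX hL hq hδ)
  have hint : ContinuousOn (fun b => ∫ u in (0 : ℝ)..N,
      scaleFunction L.psiY q u * L.excess q δ β (b - u)) (Icc 0 N) := by
    intro b hb
    have hN : 0 ≤ N := hb.1.trans hb.2
    refine intervalIntegral.continuousWithinAt_of_dominated_interval
      (bound := fun u => scaleFunction L.psiY q u * L.excess q δ β N)
      (Eventually.of_forall fun c => ?_) ?_ ?_ ?_
    · exact (intervalIntegrable_scaleFunction_mul hL hq
        (by fun_prop : Continuous fun u => L.excess q δ β (c - u)) 0 N).def'.aestronglyMeasurable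
    · filter_upwards [self_mem_nhdsWithin] with c hcN
      refine Eventually.of_forall fun u hu => ?_
      rw [uIoc_of_le hN] at hu
      have hW := (L.isScaleFunction_psiY hL hq).nonneg u
      rw [Real.norm_of_nonneg (mul_nonneg hW (L.excess_nonneg _ _ _ _))]
      exact mul_le_mul_of_nonneg_left
        (monotone_excess hL hq hδ hβ.1 (by linarith [hu.1, hcN.2])) hW
    · exact intervalIntegrable_scaleFunction_mul hL hq continuous_const 0 N
    · exact Eventually.of_forall fun u _ =>
        (by fun_prop : Continuous fun c => scaleFunction L.psiY q u *
          L.excess q δ β (c - u)).continuousWithinAt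
  have heq : ContinuousOn (fun b => L.bigGamma q ρ δ β 0 0 - q * β * scaleZbar (L.psiX δ) q b -
      q * δ * ∫ u in (0 : ℝ)..N, scaleFunction L.psiY q u * L.excess q δ β (b - u)) (Icc 0 N) :=
    (by fun_prop : Continuous fun b => L.bigGamma q ρ δ β 0 0 -
      q * β * scaleZbar (L.psiX δ) q b).continuousOn.sub (continuousOn_const.mul hint)
  refine heq.congr fun b hb => ?_
  rw [minGamma, integral_excess_extend hL hq hδ hβ hb.2
    (scaleZ_le_inv_of_nonpos hL hq hδ hβ (by linarith))]

theorem exists_minGamma_eq_zero {L : LevyTriplet} (hL : L.NotSubordinator) {q δ : ℝ} (hq : 0 < q)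
    (hδ : 0 < δ) (ρ : ℝ) {β : ℝ} (hβ : β ∈ Ioo (0 : ℝ) 1)
    (hpos : 0 < L.bigGamma q ρ δ β 0 0) : ∃ b > 0, L.minGamma q ρ δ β b = 0 := by
  have hqβ : 0 < q * β := mul_pos hq hβ.1
  -- Since `Z̄_X(N) ≥ N`, the term `qβ Z̄_X(N)` already absorbs `Γ(0,0)`.
  set N := L.bigGamma q ρ δ β 0 0 / (q * β) with hN
  have hN0 : 0 ≤ N := by positivity
  have hle : L.minGamma q ρ δ β N ≤ 0 := by
    have h1 := minGamma_le hL hq hδ ρ β hN0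
    have h2 := mul_le_mul_of_nonneg_left
      (le_scaleZbar (L.isScaleFunction_psiX hL hq hδ) hq hN0) hqβ.le
    have h3 : q * β * N = L.bigGamma q ρ δ β 0 0 := by
      rw [hN, mul_div_cancel₀ _ hqβ.ne']
    linarith
  obtain ⟨b, hb, hb0⟩ := intermediate_value_Icc' hN0 (continuousOn_minGamma hL hq hδ ρ hβ N)
    ⟨hle, by rw [minGamma_zero]; exact hpos.le⟩
  refine ⟨b, lt_of_le_of_ne hb.1 ?_, hb0⟩
  rintro rfl
  rw [minGamma_zero] at hb0
  linarith

/-- Strict monotonicity of `Z_X` turns `γ(0,b) ≥ 0` into `b ≤ k` and `γ(a,b) = 0` into `b - a = k`.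
The last two alternatives thus merge into `a = max 0 (b - k)`, where `Γ` equals `minGamma`. -/
theorem isOptimalLevels_iff {L : LevyTriplet} (hL : L.NotSubordinator) {q δ : ℝ} (hq : 0 < q)
    (hδ : 0 < δ) (ρ : ℝ) {β : ℝ} (hβ : β ∈ Ioo (0 : ℝ) 1) {k : ℝ} (hk : 0 < k)
    (hkZ : scaleZ (L.psiX δ) q k = β⁻¹) (p : ℝ × ℝ) :
    L.IsOptimalLevels q ρ δ β p ↔
      (L.bigGamma q ρ δ β 0 0 ≤ 0 ∧ p = (0, 0)) ∨
      (0 < L.bigGamma q ρ δ β 0 0 ∧ 0 < p.2 ∧ p.1 = max 0 (p.2 - k) ∧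
        L.minGamma q ρ δ β p.2 = 0) := by
  obtain ⟨a, b⟩ := p
  have hstrict := strictMonoOn_scaleZ (L.isScaleFunction_psiX hL hq hδ) hq
    (L.scaleFunction_psiX_pos hL hq hδ)
  simp only [IsOptimalLevels, Prod.mk.injEq]
  constructor
  · rintro (⟨ha, hb, h⟩ | ⟨ha, hb, hG, hg, h⟩ | ⟨ha, hab, hG, hg, h⟩)
    · exact Or.inl ⟨h, ha, hb⟩
    · have hbk : b ≤ k := by
        rw [smallGamma, sub_zero, ← hkZ, sub_nonneg] at hg
        exact (hstrict.le_iff_le hb.le hk.le).1 hg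
      have hmax : max 0 (b - k) = 0 := max_eq_left (by linarith)
      refine Or.inr ⟨h, hb, by rw [ha, hmax], ?_⟩
      rw [← bigGamma_max_eq_minGamma hL hq hδ ρ hβ hk.le hkZ hb.le, hmax]
      rwa [ha] at hG
    · have hbk : b - a = k := by
        rw [smallGamma, ← hkZ, sub_eq_zero] at hg
        exact (hstrict.injOn hk.le (sub_pos.2 hab).le hg).symm
      have hmax : max 0 (b - k) = a := by rw [← hbk, sub_sub_cancel, max_eq_right ha.le]
      refine Or.inr ⟨h, ha.trans hab, hmax.symm, ?_⟩
      rw [← bigGamma_max_eq_minGamma hL hq hδ ρ hβ hk.le hkZ (ha.trans hab).le, hmax, hG]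
  · rintro (⟨h, ha, hb⟩ | ⟨h, hb, ha, hm⟩)
    · exact Or.inl ⟨ha, hb, h⟩
    · rw [← bigGamma_max_eq_minGamma hL hq hδ ρ hβ hk.le hkZ hb.le, ← ha] at hm
      rcases le_or_gt b k with hbk | hbk
      · rw [max_eq_left (by linarith)] at ha
        refine Or.inr (Or.inl ⟨ha, hb, hm, ?_, h⟩)
        rw [smallGamma, sub_zero, ← hkZ, sub_nonneg]
        exact hstrict.monotoneOn hb.le hk.le hbk
      · rw [max_eq_right (by linarith)] at ha
        refine Or.inr (Or.inr ⟨by linarith, by linarith, hm, ?_, h⟩)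
        rw [smallGamma, ha, sub_sub_cancel, hkZ, sub_self]

theorem exists_scaleZ_psiX_eq_inv {L : LevyTriplet} (hL : L.NotSubordinator) {q δ : ℝ}
    (hq : 0 < q) (hδ : 0 < δ) {β : ℝ} (hβ : β ∈ Ioo (0 : ℝ) 1) :
    ∃ k > 0, scaleZ (L.psiX δ) q k = β⁻¹ :=
  exists_scaleZ_eq (L.isScaleFunction_psiX hL hq hδ) hq (L.scaleFunction_psiX_pos hL hq hδ)
    ((one_lt_inv₀ hβ.1).2 hβ.2)

theorem existsUnique_isOptimalLevels {L : LevyTriplet} (hL : L.NotSubordinator) {q δ : ℝ}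
    (hq : 0 < q) (hδ : 0 < δ) (ρ : ℝ) {β : ℝ} (hβ : β ∈ Ioo (0 : ℝ) 1) :
    ∃! p, L.IsOptimalLevels q ρ δ β p := by
  obtain ⟨k, hk, hkZ⟩ := exists_scaleZ_psiX_eq_inv hL hq hδ hβ
  simp only [isOptimalLevels_iff hL hq hδ ρ hβ hk hkZ]
  rcases le_or_gt (L.bigGamma q ρ δ β 0 0) 0 with h | h
  · refine ⟨(0, 0), Or.inl ⟨h, rfl⟩, ?_⟩
    rintro p (⟨-, hp⟩ | ⟨hp, -⟩)
    · exact hp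
    · exact absurd hp (not_lt.2 h)
  · obtain ⟨b, hb, hb0⟩ := exists_minGamma_eq_zero hL hq hδ ρ hβ h
    refine ⟨(max 0 (b - k), b), Or.inr ⟨h, hb, rfl, hb0⟩, ?_⟩
    rintro ⟨a', b'⟩ (⟨hp, -⟩ | ⟨-, hb', ha', hm'⟩)
    · exact absurd hp (not_le.2 h)
    · have : b' = b := (strictAntiOn_minGamma hL hq hδ ρ hβ).injOn hb'.le hb.le
        (hm'.trans hb0.symm)
      dsimp only at ha'
      rw [ha', this]

theorem isOptimalLevels_star {L : LevyTriplet} (hL : L.NotSubordinator) {q δ : ℝ}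
    (hq : 0 < q) (hδ : 0 < δ) (ρ : ℝ) {β : ℝ} (hβ : β ∈ Ioo (0 : ℝ) 1) :
    L.IsOptimalLevels q ρ δ β (L.aStar q ρ δ β, L.bStar q ρ δ β) :=
  Classical.epsilon_spec (existsUnique_isOptimalLevels hL hq hδ ρ hβ).exists

theorem eq_star {L : LevyTriplet} (hL : L.NotSubordinator) {q δ : ℝ}
    (hq : 0 < q) (hδ : 0 < δ) (ρ : ℝ) {β : ℝ} (hβ : β ∈ Ioo (0 : ℝ) 1) {p : ℝ × ℝ}
    (hp : L.IsOptimalLevels q ρ δ β p) : p = (L.aStar q ρ δ β, L.bStar q ρ δ β) :=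
  (existsUnique_isOptimalLevels hL hq hδ ρ hβ).unique hp (isOptimalLevels_star hL hq hδ ρ hβ)

theorem star_eq_zero {L : LevyTriplet} (hL : L.NotSubordinator) {q δ : ℝ}
    (hq : 0 < q) (hδ : 0 < δ) {ρ β : ℝ} (hβ : β ∈ Ioo (0 : ℝ) 1)
    (h : L.bigGamma q ρ δ β 0 0 ≤ 0) : L.aStar q ρ δ β = 0 ∧ L.bStar q ρ δ β = 0 := by
  have := eq_star hL hq hδ ρ hβ (p := (0, 0)) (Or.inl ⟨rfl, rfl, h⟩)
  simp only [Prod.mk.injEq] at this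
  exact ⟨this.1.symm, this.2.symm⟩

/-- The characterization of the optimal levels when `Γ(0,0) > 0`. -/
theorem star_spec {L : LevyTriplet} (hL : L.NotSubordinator) {q δ : ℝ}
    (hq : 0 < q) (hδ : 0 < δ) {ρ β : ℝ} (hβ : β ∈ Ioo (0 : ℝ) 1)
    (h : 0 < L.bigGamma q ρ δ β 0 0) {k : ℝ} (hk : 0 < k)
    (hkZ : scaleZ (L.psiX δ) q k = β⁻¹) :
    0 < L.bStar q ρ δ β ∧ L.aStar q ρ δ β = max 0 (L.bStar q ρ δ β - k) ∧
      L.minGamma q ρ δ β (L.bStar q ρ δ β) = 0 := by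
  rcases (isOptimalLevels_iff hL hq hδ ρ hβ hk hkZ _).1 (isOptimalLevels_star hL hq hδ ρ hβ) with
    ⟨h', -⟩ | ⟨-, h'⟩
  · exact absurd h' (not_le.2 h)
  · exact h'

theorem bStar_pos_iff {L : LevyTriplet} (hL : L.NotSubordinator) {q δ : ℝ}
    (hq : 0 < q) (hδ : 0 < δ) {ρ β : ℝ} (hβ : β ∈ Ioo (0 : ℝ) 1) :
    0 < L.bStar q ρ δ β ↔ 0 < L.bigGamma q ρ δ β 0 0 := by
  constructor
  · intro hb
    by_contra! h
    linarith [(star_eq_zero hL hq hδ hβ h).2]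
  · intro h
    obtain ⟨k, hk, hkZ⟩ := exists_scaleZ_psiX_eq_inv hL hq hδ hβ
    exact (star_spec hL hq hδ hβ h hk hkZ).1

/-- For `Z_X(b) ≤ 1/β` the integral in `minGamma` is zero, so the last hypothesis says that the
decreasing function `minGamma` is still positive at `b`. -/
theorem lt_bStar {L : LevyTriplet} (hL : L.NotSubordinator) {q δ : ℝ}
    (hq : 0 < q) (hδ : 0 < δ) {ρ β : ℝ} (hβ : β ∈ Ioo (0 : ℝ) 1) {b : ℝ} (hb : 0 ≤ b)
    (hZ : scaleZ (L.psiX δ) q b ≤ β⁻¹)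
    (h : 0 < L.bigGamma q ρ δ β 0 0 - q * β * scaleZbar (L.psiX δ) q b) :
    b < L.bStar q ρ δ β := by
  have h0 : 0 < L.bigGamma q ρ δ β 0 0 := by
    have := mul_nonneg (mul_nonneg hq.le hβ.1.le)
      (hb.trans (le_scaleZbar (L.isScaleFunction_psiX hL hq hδ) hq hb))
    linarith
  obtain ⟨k, hk, hkZ⟩ := exists_scaleZ_psiX_eq_inv hL hq hδ hβ
  obtain ⟨h1, -, h2⟩ := star_spec hL hq hδ hβ h0 hk hkZ
  rw [← minGamma_of_scaleZ_le hL hq hδ ρ hβ hb hZ, ← h2] at h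
  exact ((strictAntiOn_minGamma hL hq hδ ρ hβ).lt_iff_gt h1.le hb).1 h

theorem bStar_le {L : LevyTriplet} (hL : L.NotSubordinator) {q δ : ℝ}
    (hq : 0 < q) (hδ : 0 < δ) {ρ β : ℝ} (hβ : β ∈ Ioo (0 : ℝ) 1)
    (h : 0 < L.bigGamma q ρ δ β 0 0) :
    L.bStar q ρ δ β ≤ L.bigGamma q ρ δ β 0 0 / (q * β) := by
  obtain ⟨k, hk, hkZ⟩ := exists_scaleZ_psiX_eq_inv hL hq hδ hβ
  obtain ⟨h1, -, h2⟩ := star_spec hL hq hδ hβ h hk hkZ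
  have h3 := minGamma_le hL hq hδ ρ β h1.le
  have h4 := mul_le_mul_of_nonneg_left
    (le_scaleZbar (L.isScaleFunction_psiX hL hq hδ) hq h1.le) (mul_pos hq hβ.1).le
  rw [le_div_iff₀ (mul_pos hq hβ.1)]
  linarith

theorem aStar_nonneg {L : LevyTriplet} (hL : L.NotSubordinator) {q δ : ℝ}
    (hq : 0 < q) (hδ : 0 < δ) (ρ : ℝ) {β : ℝ} (hβ : β ∈ Ioo (0 : ℝ) 1) :
    0 ≤ L.aStar q ρ δ β ∧ L.aStar q ρ δ β ≤ L.bStar q ρ δ β := by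
  rcases isOptimalLevels_star hL hq hδ ρ hβ with h | h | h
  · exact ⟨h.1.ge, (h.1.trans h.2.1.symm).le⟩
  · exact ⟨h.1.ge, h.1.trans_le h.2.1.le⟩
  · exact ⟨h.1.le, h.2.1.le⟩

end LevyTriplet

/-! ### The limits `β ↓ 0`, `β ↑ 1` and `δ ↑ ∞` -/

namespace LevyTriplet

/-- Since `ψ_X ≥ ψ_Y` on `[0, ∞)`, the root for `X` lies no further right than `φ`. One `θ`
therefore serves for every `δ`. -/
theorem rightInverse_psiX_lt {L : LevyTriplet} (hL : L.NotSubordinator) {q δ φ θ : ℝ} (hq : 0 < q)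
    (hδ : 0 < δ) (hφ : 0 < φ) (hψ : L.psiY φ = q) (hθ : φ < θ) :
    rightInverse (L.psiX δ) q < θ := by
  obtain ⟨φ', hφ', hψ'⟩ := (L.addDrift δ).exists_psiY_eq (hL.addDrift hδ) hq
  rw [← psiY_addDrift, rightInverse_eq _ hq hφ' hψ']
  refine lt_of_le_of_lt (not_lt.1 fun hlt => ?_) hθ
  have h1 := L.lt_psiY_of_lt hq hφ hψ hlt
  rw [psiY_addDrift, psiX] at hψ'
  linarith [mul_pos hδ hφ']

/-- Markov's inequality: on `[0, b]` one has `1 ≤ exp(θ b) exp(-θ x)`, which bounds `∫_0^b W_X` by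
the Laplace transform. -/
theorem scaleZ_psiX_le {L : LevyTriplet} (hL : L.NotSubordinator) {q δ φ θ : ℝ} (hq : 0 < q)
    (hδ : 0 < δ) (hφ : 0 < φ) (hψ : L.psiY φ = q) (hθ : φ < θ) {b : ℝ} (hb : 0 ≤ b) :
    scaleZ (L.psiX δ) q b ≤ 1 + q * (Real.exp (θ * b) * (1 / (L.psiY θ + δ * θ - q))) := by
  have h := L.isScaleFunction_psiX hL hq hδ
  obtain ⟨hi, he⟩ := h.laplace θ (rightInverse_psiX_lt hL hq hδ hφ hψ hθ)
  have hi' : IntegrableOn (fun x => Real.exp (θ * b) *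
      (Real.exp (-θ * x) * scaleFunction (L.psiX δ) q x)) (Ioi 0) :=
    hi.const_mul (Real.exp (θ * b))
  rw [psiX] at he
  rw [scaleZ, ← he]
  gcongr
  rw [intervalIntegral.integral_of_le hb, ← integral_const_mul]
  calc ∫ x in Ioc 0 b, scaleFunction (L.psiX δ) q x
      ≤ ∫ x in Ioc 0 b, Real.exp (θ * b) * (Real.exp (-θ * x) * scaleFunction (L.psiX δ) q x) := by
        refine setIntegral_mono_on (h.monotone.intervalIntegrable (a := 0) (b := b)).1
          (hi'.mono_set Ioc_subset_Ioi_self) measurableSet_Ioc fun x hx => ?_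
        rw [← mul_assoc, ← Real.exp_add]
        refine le_mul_of_one_le_left (h.nonneg x) (Real.one_le_exp ?_)
        nlinarith [hx.2, hφ.trans hθ]
    _ ≤ ∫ x in Ioi 0, Real.exp (θ * b) * (Real.exp (-θ * x) * scaleFunction (L.psiX δ) q x) := by
        refine setIntegral_mono_set hi' (Eventually.of_forall fun x => ?_)
          Ioc_subset_Ioi_self.eventuallyLE
        exact mul_nonneg (Real.exp_pos _).le (mul_nonneg (Real.exp_pos _).le (h.nonneg x))

/-- As the drift grows, `Z_X` tends to `1`. -/
theorem eventually_scaleZ_psiX_le {L : LevyTriplet} (hL : L.NotSubordinator) {q : ℝ} (hq : 0 < q)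
    {b c : ℝ} (hb : 0 ≤ b) (hc : 1 < c) : ∀ᶠ δ in atTop, scaleZ (L.psiX δ) q b ≤ c := by
  obtain ⟨φ, hφ, hψ⟩ := L.exists_psiY_eq hL hq
  have hθ : φ < φ + 1 := by linarith
  have hden : Tendsto (fun δ : ℝ => L.psiY (φ + 1) + δ * (φ + 1) - q) atTop atTop :=
    tendsto_atTop_add_const_right _ (-q) (tendsto_atTop_add_const_left _ _
      (tendsto_id.atTop_mul_const (by linarith)))
  have hlim := ((hden.inv_tendsto_atTop.const_mul (Real.exp ((φ + 1) * b))).const_mul q).const_add 1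
  rw [mul_zero, mul_zero, add_zero] at hlim
  filter_upwards [eventually_gt_atTop 0, hlim.eventually_le_const hc] with δ hδ h
  refine (scaleZ_psiX_le hL hq hδ hφ hψ hθ hb).trans ?_
  rw [one_div]
  exact h

theorem tendsto_bigGamma_zero (L : LevyTriplet) {q : ℝ} (hq : 0 < q) (ρ δ : ℝ) :
    Tendsto (fun β => L.bigGamma q ρ δ β 0 0) (𝓝[>] 0) (𝓝 (δ - q * ρ)) := by
  simp_rw [bigGamma_zero_zero L hq]
  have : Continuous fun β : ℝ => δ - q * ρ - β * rightDerivZero (L.psiX δ) := by fun_prop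
  simpa using (this.tendsto 0).mono_left nhdsWithin_le_nhds

theorem tendsto_bigGamma_one (L : LevyTriplet)
    (hmean : DifferentiableWithinAt ℝ L.psiY (Ici 0) 0) {q : ℝ} (hq : 0 < q) (ρ δ : ℝ) :
    Tendsto (fun β => L.bigGamma q ρ δ β 0 0) (𝓝[<] 1) (𝓝 (-rightDerivZero L.psiY - q * ρ)) := by
  simp_rw [bigGamma_zero_zero L hq, L.rightDerivZero_psiX hmean]
  have : Continuous fun β : ℝ => δ - q * ρ - β * (rightDerivZero L.psiY + δ) := by fun_prop
  convert (this.tendsto 1).mono_left nhdsWithin_le_nhds using 2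
  ring

theorem tendsto_bStar_atTop_of_lt {L : LevyTriplet} (hL : L.NotSubordinator) {q ρ δ : ℝ}
    (hq : 0 < q) (hδ : 0 < δ) (h : q * ρ < δ) :
    Tendsto (fun β => L.bStar q ρ δ β) (𝓝[>] 0) atTop := by
  refine tendsto_atTop.2 fun B => ?_
  have h1 : Tendsto (fun β => L.bigGamma q ρ δ β 0 0 -
      q * β * scaleZbar (L.psiX δ) q (max B 0)) (𝓝[>] 0) (𝓝 (δ - q * ρ)) := by
    have : Continuous fun β : ℝ => q * β * scaleZbar (L.psiX δ) q (max B 0) := by fun_prop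
    simpa using (L.tendsto_bigGamma_zero hq ρ δ).sub
      ((this.tendsto 0).mono_left nhdsWithin_le_nhds)
  filter_upwards [Ioo_mem_nhdsGT one_pos, h1.eventually_const_lt (sub_pos.2 h),
    tendsto_inv_nhdsGT_zero.eventually_ge_atTop (scaleZ (L.psiX δ) q (max B 0))]
    with β hβ hG hZ
  exact (le_max_left B 0).trans (lt_bStar hL hq hδ hβ (le_max_right _ _) hZ hG).le

/-- Fix `η ≤ ε` so small that `Γ(0,0) - qβ Z̄_X(η)` has a positive limit. Since `1/β → 1 < Z_X(η)`,
eventually `k < η`; then `lt_bStar` applies at `k`, giving `b* > k` and `b* - a* = k < ε`. -/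
theorem eventually_layers_beta_one {L : LevyTriplet} (hL : L.NotSubordinator)
    (hmean : DifferentiableWithinAt ℝ L.psiY (Ici 0) 0) {q ρ δ : ℝ} (hq : 0 < q) (hδ : 0 < δ)
    (h : rightDerivZero L.psiY + q * ρ < 0) {ε : ℝ} (hε : 0 < ε) :
    ∀ᶠ β in 𝓝[<] (1 : ℝ), (0 < L.aStar q ρ δ β ∧ L.aStar q ρ δ β < L.bStar q ρ δ β ∧
      scaleZ (L.psiX δ) q (L.bStar q ρ δ β - L.aStar q ρ δ β) = β⁻¹) ∧
      L.bStar q ρ δ β - L.aStar q ρ δ β < ε := by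
  have hWX := L.isScaleFunction_psiX hL hq hδ
  have hG : 0 < -rightDerivZero L.psiY - q * ρ := by linarith
  obtain ⟨η, hη0, hηε, hη⟩ : ∃ η > 0, η ≤ ε ∧
      q * scaleZbar (L.psiX δ) q η < -rightDerivZero L.psiY - q * ρ := by
    have hc : Continuous fun x => q * scaleZbar (L.psiX δ) q x :=
      continuous_const.mul (continuous_scaleZbar hWX)
    have h0 := hc.tendsto 0
    rw [scaleZbar_zero, mul_zero] at h0
    obtain ⟨η, hη, hη'⟩ := (((h0.mono_left nhdsWithin_le_nhds).eventually_lt_const hG).and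
      (Ioc_mem_nhdsGT hε)).exists
    exact ⟨η, hη'.1, hη'.2, hη⟩
  have h1 : Tendsto (fun β => L.bigGamma q ρ δ β 0 0 - q * β * scaleZbar (L.psiX δ) q η)
      (𝓝[<] 1) (𝓝 (-rightDerivZero L.psiY - q * ρ - q * 1 * scaleZbar (L.psiX δ) q η)) := by
    have : Continuous fun β : ℝ => q * β * scaleZbar (L.psiX δ) q η := by fun_prop
    exact (L.tendsto_bigGamma_one hmean hq ρ δ).sub
      ((this.tendsto 1).mono_left nhdsWithin_le_nhds)
  have hstrict := strictMonoOn_scaleZ hWX hq (L.scaleFunction_psiX_pos hL hq hδ)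
  have hZη : 1 < scaleZ (L.psiX δ) q η := by
    rw [← scaleZ_zero (ψ := L.psiX δ) (q := q)]
    exact hstrict self_mem_Ici hη0.le hη0
  have h2 : Tendsto (fun β : ℝ => β⁻¹) (𝓝[<] 1) (𝓝 1) := by
    simpa using (tendsto_inv₀ (one_ne_zero (α := ℝ))).mono_left nhdsWithin_le_nhds
  filter_upwards [Ioo_mem_nhdsLT one_pos, h1.eventually_const_lt (by linarith : (0 : ℝ) < _),
    h2.eventually_lt_const hZη] with β hβ hGβ hZβ
  obtain ⟨k, hk, hkZ⟩ := exists_scaleZ_psiX_eq_inv hL hq hδ hβ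
  have hkη : k < η := by
    rw [← hkZ] at hZβ
    exact (hstrict.lt_iff_lt hk.le hη0.le).1 hZβ
  have hmul := mul_lt_mul_of_pos_left (strictMono_scaleZbar hWX hq hkη) (mul_pos hq hβ.1)
  have hkb : k < L.bStar q ρ δ β := lt_bStar hL hq hδ hβ hk.le hkZ.le (by linarith)
  have hΓ : 0 < L.bigGamma q ρ δ β 0 0 := (bStar_pos_iff hL hq hδ hβ).1 (hk.trans hkb)
  obtain ⟨-, ha, -⟩ := star_spec hL hq hδ hβ hΓ hk hkZ
  rw [max_eq_right (by linarith)] at ha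
  have hba : L.bStar q ρ δ β - L.aStar q ρ δ β = k := by rw [ha]; ring
  refine ⟨⟨by linarith, by linarith, by rw [hba, hkZ]⟩, by linarith⟩

theorem tendsto_bigGamma_delta (L : LevyTriplet)
    (hmean : DifferentiableWithinAt ℝ L.psiY (Ici 0) 0) {q : ℝ} (hq : 0 < q) (ρ : ℝ) {β : ℝ}
    (hβ : β ∈ Ioo (0 : ℝ) 1) : Tendsto (fun δ => L.bigGamma q ρ δ β 0 0) atTop atTop := by
  have h : ∀ δ, L.bigGamma q ρ δ β 0 0 = δ * (1 - β) + (-q * ρ - β * rightDerivZero L.psiY) := by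
    intro δ
    rw [bigGamma_zero_zero L hq, L.rightDerivZero_psiX hmean]
    ring
  simp_rw [h]
  exact tendsto_atTop_add_const_right _ _ (tendsto_id.atTop_mul_const (by linarith [hβ.2]))

/-- At a fixed level `b`, eventually `Z_X(b) ≤ 1/β`, so `Z̄_X(b) ≤ b/β` stays bounded while `Γ(0,0)`
diverges. -/
theorem tendsto_bStar_delta {L : LevyTriplet} (hL : L.NotSubordinator)
    (hmean : DifferentiableWithinAt ℝ L.psiY (Ici 0) 0) {q : ℝ} (hq : 0 < q) (ρ : ℝ) {β : ℝ}
    (hβ : β ∈ Ioo (0 : ℝ) 1) : Tendsto (fun δ => L.bStar q ρ δ β) atTop atTop := by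
  refine tendsto_atTop.2 fun B => ?_
  have hB : 0 ≤ max B 0 := le_max_right _ _
  filter_upwards [eventually_gt_atTop 0,
    eventually_scaleZ_psiX_le hL hq hB ((one_lt_inv₀ hβ.1).2 hβ.2),
    (L.tendsto_bigGamma_delta hmean hq ρ hβ).eventually_gt_atTop
      (q * β * (max B 0 * β⁻¹))] with δ hδ hZ hG
  refine (le_max_left B 0).trans (lt_bStar hL hq hδ hβ hB hZ ?_).le
  have h1 := scaleZbar_le_mul (L.isScaleFunction_psiX hL hq hδ) hq hB
  have h2 := mul_le_mul_of_nonneg_left (h1.trans (mul_le_mul_of_nonneg_left hZ hB))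
    (mul_pos hq hβ.1).le
  linarith

/-- When `qρ = δ`, `Γ(0,b) = -β (ψ_X'(0+) + q Z̄_X(b))`, whose zero `c` does not depend on `β`. Once
`1/β ≥ Z_X(c)`, the pair `(0, c)` is exactly optimal. -/
theorem exists_limit_beta_zero {L : LevyTriplet} (hL : L.NotSubordinator) {q ρ δ : ℝ} (hq : 0 < q)
    (hδ : 0 < δ) (hρ : q * ρ = δ) (hneg : rightDerivZero (L.psiX δ) < 0) :
    ∃ c > 0, scaleZbar (L.psiX δ) q c = -rightDerivZero (L.psiX δ) / q ∧
      ∀ᶠ β in 𝓝[>] (0 : ℝ), L.aStar q ρ δ β = 0 ∧ L.bStar q ρ δ β = c := by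
  obtain ⟨c, hc, hcZ⟩ := exists_scaleZbar_eq (L.isScaleFunction_psiX hL hq hδ) hq
    (div_pos (neg_pos.2 hneg) hq)
  refine ⟨c, hc, hcZ, ?_⟩
  filter_upwards [Ioo_mem_nhdsGT one_pos,
    tendsto_inv_nhdsGT_zero.eventually_ge_atTop (scaleZ (L.psiX δ) q c)] with β hβ hZ
  have hΓ : L.bigGamma q ρ δ β 0 0 = β * -rightDerivZero (L.psiX δ) := by
    rw [bigGamma_zero_zero L hq, hρ]
    ring
  have hopt : L.IsOptimalLevels q ρ δ β (0, c) := by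
    refine Or.inr (Or.inl ⟨rfl, hc, ?_, ?_, ?_⟩)
    · rw [bigGamma_zero_left hL hq hδ, hΓ, hcZ]
      field_simp
      ring
    · rw [smallGamma, sub_zero, sub_nonneg]
      exact hZ
    · rw [hΓ]
      exact mul_pos hβ.1 (neg_pos.2 hneg)
  have := eq_star hL hq hδ ρ hβ hopt
  simp only [Prod.mk.injEq] at this
  exact ⟨this.1.symm, this.2.symm⟩

/-- Here `Γ(0,0) → 0`, and `0 ≤ a* ≤ b* ≤ Γ(0,0) / (qβ)`. -/
theorem tendsto_star_beta_one_zero {L : LevyTriplet} (hL : L.NotSubordinator)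
    (hmean : DifferentiableWithinAt ℝ L.psiY (Ici 0) 0) {q ρ δ : ℝ} (hq : 0 < q) (hδ : 0 < δ)
    (h : rightDerivZero L.psiY + q * ρ = 0)
    (hpos : ∀ β ∈ Ioo (0 : ℝ) 1, 0 < L.bigGamma q ρ δ β 0 0) :
    Tendsto (fun β => L.aStar q ρ δ β) (𝓝[<] 1) (𝓝 0) ∧
      Tendsto (fun β => L.bStar q ρ δ β) (𝓝[<] 1) (𝓝 0) := by
  have hev : ∀ᶠ β in 𝓝[<] (1 : ℝ), β ∈ Ioo (0 : ℝ) 1 := Ioo_mem_nhdsLT one_pos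
  have hb : Tendsto (fun β => L.bStar q ρ δ β) (𝓝[<] 1) (𝓝 0) := by
    have h1 : Tendsto (fun β => L.bigGamma q ρ δ β 0 0 / (q * β)) (𝓝[<] 1) (𝓝 0) := by
      have h2 : Tendsto (fun β : ℝ => q * β) (𝓝[<] 1) (𝓝 (q * 1)) :=
        ((continuous_const.mul continuous_id).tendsto 1).mono_left nhdsWithin_le_nhds
      have h3 := (L.tendsto_bigGamma_one hmean hq ρ δ).div h2 (by simpa using hq.ne')
      rwa [show -rightDerivZero L.psiY - q * ρ = 0 by linarith, zero_div] at h3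
    refine tendsto_of_tendsto_of_tendsto_of_le_of_le' tendsto_const_nhds h1 ?_ ?_
    · filter_upwards [hev] with β hβ using ((bStar_pos_iff hL hq hδ hβ).2 (hpos β hβ)).le
    · filter_upwards [hev] with β hβ using bStar_le hL hq hδ hβ (hpos β hβ)
  refine ⟨tendsto_of_tendsto_of_tendsto_of_le_of_le' tendsto_const_nhds hb ?_ ?_, hb⟩
  · filter_upwards [hev] with β hβ using (aStar_nonneg hL hq hδ ρ hβ).1
  · filter_upwards [hev] with β hβ using (aStar_nonneg hL hq hδ ρ hβ).2

end LevyTriplet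

end

/-- Asymptotics of the optimal layer levels. The first two conjuncts record that the scale
functions and the levels `(a*, b*)` exist (the latter uniquely); the others are the limits
`β ↓ 0`, `β ↑ 1` and `δ ↑ ∞`. -/
theorem mainTheorem6 (L : LevyTriplet) (hL : L.NotSubordinator)
    (hmean : DifferentiableWithinAt ℝ L.psiY (Ici 0) 0) (q ρ : ℝ) (hq : 0 < q) :
    -- the objects are well defined
    (IsScaleFunction L.psiY q (scaleFunction L.psiY q) ∧
      ∀ δ : ℝ, 0 < δ → IsScaleFunction (L.psiX δ) q (scaleFunction (L.psiX δ) q)) ∧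
    (∀ δ : ℝ, 0 < δ → ∀ β ∈ Ioo (0 : ℝ) 1,
      L.IsOptimalLevels q ρ δ β (L.aStar q ρ δ β, L.bStar q ρ δ β) ∧
      (∀ p : ℝ × ℝ, L.IsOptimalLevels q ρ δ β p → p = (L.aStar q ρ δ β, L.bStar q ρ δ β)) ∧
      L.bigGamma q ρ δ β 0 0 = δ - q * ρ - β * rightDerivZero (L.psiX δ) ∧
      (0 < L.bStar q ρ δ β ↔ 0 < L.bigGamma q ρ δ β 0 0)) ∧
    -- (i) limits as `β ↓ 0`
    (∀ δ : ℝ, 0 < δ →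
      Tendsto (fun β => L.bigGamma q ρ δ β 0 0) (𝓝[>] 0) (𝓝 (δ - q * ρ)) ∧
      (q * ρ / δ < 1 →
        Tendsto (fun β => L.bStar q ρ δ β) (𝓝[>] 0) atTop) ∧
      (1 < q * ρ / δ →
        ∀ᶠ β in 𝓝[>] (0 : ℝ), L.aStar q ρ δ β = 0 ∧ L.bStar q ρ δ β = 0) ∧
      (q * ρ / δ = 1 → rightDerivZero (L.psiX δ) < 0 →
        (∀ β ∈ Ioo (0 : ℝ) 1, 0 < L.bStar q ρ δ β) ∧
        (∃ c : ℝ, 0 < c ∧ scaleZbar (L.psiX δ) q c = -rightDerivZero (L.psiX δ) / q ∧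
          (∀ c' : ℝ, scaleZbar (L.psiX δ) q c' = -rightDerivZero (L.psiX δ) / q → c' = c) ∧
          Tendsto (fun β => L.bStar q ρ δ β) (𝓝[>] 0) (𝓝 c)) ∧
        (∀ᶠ β in 𝓝[>] (0 : ℝ), L.aStar q ρ δ β = 0) ∧
        Tendsto (fun β => L.aStar q ρ δ β) (𝓝[>] 0) (𝓝 0)) ∧
      (q * ρ / δ = 1 → 0 ≤ rightDerivZero (L.psiX δ) →
        ∀ β ∈ Ioo (0 : ℝ) 1, L.aStar q ρ δ β = 0 ∧ L.bStar q ρ δ β = 0)) ∧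
    -- (ii) limits as `β ↑ 1`
    (∀ δ : ℝ, 0 < δ →
      Tendsto (fun β => L.bigGamma q ρ δ β 0 0) (𝓝[<] 1)
        (𝓝 (-rightDerivZero L.psiY - q * ρ)) ∧
      (rightDerivZero L.psiY + q * ρ < 0 →
        (∀ᶠ β in 𝓝[<] (1 : ℝ), 0 < L.aStar q ρ δ β ∧ L.aStar q ρ δ β < L.bStar q ρ δ β ∧
          scaleZ (L.psiX δ) q (L.bStar q ρ δ β - L.aStar q ρ δ β) = β⁻¹) ∧
        Tendsto (fun β => L.bStar q ρ δ β - L.aStar q ρ δ β) (𝓝[<] 1) (𝓝 0)) ∧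
      (0 < rightDerivZero L.psiY + q * ρ →
        ∀ᶠ β in 𝓝[<] (1 : ℝ), L.aStar q ρ δ β = 0 ∧ L.bStar q ρ δ β = 0) ∧
      (rightDerivZero L.psiY + q * ρ = 0 → 0 < rightDerivZero (L.psiX δ) →
        (∀ β ∈ Ioo (0 : ℝ) 1, 0 < L.bStar q ρ δ β) ∧
        Tendsto (fun β => L.aStar q ρ δ β) (𝓝[<] 1) (𝓝 0) ∧
        Tendsto (fun β => L.bStar q ρ δ β) (𝓝[<] 1) (𝓝 0)) ∧
      (rightDerivZero L.psiY + q * ρ = 0 → rightDerivZero (L.psiX δ) ≤ 0 →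
        ∀ β ∈ Ioo (0 : ℝ) 1, L.aStar q ρ δ β = 0 ∧ L.bStar q ρ δ β = 0)) ∧
    -- (iii) limits as `δ ↑ ∞`
    (∀ β ∈ Ioo (0 : ℝ) 1,
      Tendsto (fun δ => L.bigGamma q ρ δ β 0 0) atTop atTop ∧
      Tendsto (fun δ => L.bStar q ρ δ β) atTop atTop) := by
  have hG := fun δ β => L.bigGamma_zero_zero hq ρ δ β
  have hX := L.rightDerivZero_psiX hmean
  refine ⟨⟨L.isScaleFunction_psiY hL hq, fun δ hδ => L.isScaleFunction_psiX hL hq hδ⟩,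
    fun δ hδ β hβ => ⟨L.isOptimalLevels_star hL hq hδ ρ hβ,
      fun p hp => L.eq_star hL hq hδ ρ hβ hp, hG δ β, L.bStar_pos_iff hL hq hδ hβ⟩,
    fun δ hδ => ⟨L.tendsto_bigGamma_zero hq ρ δ, fun h => ?_, fun h => ?_, fun h hneg => ?_,
      fun h hnn β hβ => ?_⟩,
    fun δ hδ => ⟨L.tendsto_bigGamma_one hmean hq ρ δ, fun h => ?_, fun h => ?_, fun h hpos => ?_,
      fun h hnp β hβ => ?_⟩,
    fun β hβ => ⟨L.tendsto_bigGamma_delta hmean hq ρ hβ, L.tendsto_bStar_delta hL hmean hq ρ hβ⟩⟩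
  · exact LevyTriplet.tendsto_bStar_atTop_of_lt hL hq hδ (by rwa [div_lt_one hδ] at h)
  · rw [one_lt_div hδ] at h
    filter_upwards [Ioo_mem_nhdsGT one_pos,
      (L.tendsto_bigGamma_zero hq ρ δ).eventually_le_const (sub_neg.2 h)] with β hβ hle
    exact LevyTriplet.star_eq_zero hL hq hδ hβ hle
  · rw [div_eq_one_iff_eq hδ.ne'] at h
    obtain ⟨c, hc, hcZ, hev⟩ := LevyTriplet.exists_limit_beta_zero hL hq hδ h hneg
    have ha : ∀ᶠ β in 𝓝[>] (0 : ℝ), L.aStar q ρ δ β = 0 := hev.mono fun β hβ => hβ.1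
    refine ⟨fun β hβ => (LevyTriplet.bStar_pos_iff hL hq hδ hβ).2 ?_, ⟨c, hc, hcZ, ?_, ?_⟩, ha, ?_⟩
    · rw [hG, h]
      nlinarith [mul_pos hβ.1 (neg_pos.2 hneg)]
    · exact fun c' hc' => (strictMono_scaleZbar (L.isScaleFunction_psiX hL hq hδ) hq).injective
        (hc'.trans hcZ.symm)
    · exact tendsto_const_nhds.congr' (hev.mono fun β hβ => hβ.2.symm)
    · exact tendsto_const_nhds.congr' (ha.mono fun β hβ => hβ.symm)
  · rw [div_eq_one_iff_eq hδ.ne'] at h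
    refine LevyTriplet.star_eq_zero hL hq hδ hβ ?_
    rw [hG, h]
    linarith [mul_nonneg hβ.1.le hnn]
  · refine ⟨(LevyTriplet.eventually_layers_beta_one hL hmean hq hδ h one_pos).mono
      fun β hβ => hβ.1, tendsto_order.2 ⟨fun a ha => ?_, fun a ha => ?_⟩⟩
    · filter_upwards [LevyTriplet.eventually_layers_beta_one hL hmean hq hδ h one_pos] with β hβ
      linarith [hβ.1.2.1]
    · exact (LevyTriplet.eventually_layers_beta_one hL hmean hq hδ h ha).mono fun β hβ => hβ.2
  · filter_upwards [Ioo_mem_nhdsLT one_pos,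
      (L.tendsto_bigGamma_one hmean hq ρ δ).eventually_le_const
        (by linarith : -rightDerivZero L.psiY - q * ρ < 0)] with β hβ hle
    exact LevyTriplet.star_eq_zero hL hq hδ hβ hle
  -- In this critical case `δ - qρ = ψ_X'(0+)`, so `Γ(0,0) = (1 - β) ψ_X'(0+)`; the next case uses
  -- the same identity.
  · have hΓ : ∀ β ∈ Ioo (0 : ℝ) 1, 0 < L.bigGamma q ρ δ β 0 0 := fun β hβ => by
      rw [hG]
      nlinarith [mul_pos (sub_pos.2 hβ.2) hpos, hX δ]
    exact ⟨fun β hβ => (LevyTriplet.bStar_pos_iff hL hq hδ hβ).2 (hΓ β hβ),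
      LevyTriplet.tendsto_star_beta_one_zero hL hmean hq hδ h hΓ⟩
  · refine LevyTriplet.star_eq_zero hL hq hδ hβ ?_
    rw [hG]
    nlinarith [mul_nonneg (sub_pos.2 hβ.2).le (neg_nonneg.2 hnp), hX δ]
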